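/- Let $n\ge 1$ be an integer. An *$n$-polygon* is a bounded closed set $Q\subset\mathbb{R}^2$ that is the closure of its interior, together with a cyclic sequence of points $v_1,\dots,v_n$ ($v_{n+1}=v_1$), its vertices, which need not be distinct, such that the segments $[v_i,v_{i+1}]$, $1\le i\le n$, its edges, are nondegenerate, their union is the topological boundary $\partial Q$, and no relative interior point of an edge $[v_i,v_{i+1}]$ lies on an edge $[v_j,v_{j+1}]$ with $j\ne i$. (So the boundary may touch itself, but only at vertices.) Put $V=\{v_1,\dots,v_n\}$. A *diagonal segment* of $Q$ is a segment $[v,w]\subset Q$ with $v,w\in V$, $v\neq w$, that is not an edge of $Q$ and satisfies $[v,w]\cap V=\{v,w\}$. A *diagonal triangulation* of $Q$ is a finite set of nondegenerate triangles with union $Q$, any two of which are disjoint or meet exactly in a common vertex or a common side, such that every side of every triangle is an edge or a diagonal segment of $Q$. **Theorem.** For every $n$ there is a constant $\theta=\theta(n)>0$, depending only on $n$, such that the following holds. Let $Q$ be an $n$-polygon all of whose edges have length one and such that any two distinct points of $V$ are at distance at least one. Then $Q$ has a diagonal triangulation in which every interior angle of every triangle is at least $\theta$. -/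

import Mathlib

/-- The Euclidean plane. -/
abbrev Plane : Type := EuclideanSpace ℝ (Fin 2)

/-- `IsPolygonWith Q P`: the set `Q` is an `n`-polygon, and its boundary is the closed curve that
runs through the cyclic sequence of labelled vertices `P 0, P 1, …, P (n - 1)`. The edges are the
segments from `P i` to the cyclically next vertex `P (finRotate n i)`. Different labels may carry
the same point, so the boundary may touch itself at vertices. -/
structure IsPolygonWith {n : ℕ} (Q : Set Plane) (P : Polygon Plane n) : Prop where
  isBounded : Bornology.IsBounded Q
  isClosed : IsClosed Q
  /-- `Q` is a polygonal domain, that is, the closure of its interior: it is not the bare boundary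
  curve and has no one-dimensional parts. -/
  closure_interior : closure (interior Q) = Q
  /-- The edges are genuine segments. -/
  nondegenerate : P.HasNondegenerateEdges
  /-- The closed curve parametrizes the whole topological boundary of `Q`. -/
  frontier_eq : frontier Q = P.boundary ℝ
  /-- A relative interior point of an edge has exactly one preimage under the closed curve: it lies
  on no other edge. (This also makes the curve locally injective at the vertices.) -/
  disjoint_edges : ∀ i j : Fin n, i ≠ j →
    Disjoint (openSegment ℝ (P i) (P (finRotate n i))) (P.edgeSet ℝ j)

/-- The points `v` and `w` are the two endpoints of an edge of the polygon. -/
def IsPolygonEdge {n : ℕ} (P : Polygon Plane n) (v w : Plane) : Prop :=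
  ∃ i : Fin n, s(v, w) = s(P i, P (finRotate n i))

/-- The segment `[v, w]` is a diagonal segment of the polygon `Q`: `v` and `w` are two distinct
vertices, `[v, w]` lies in `Q`, is not an edge, and contains no vertex besides `v` and `w`. -/
structure IsDiagonalSegment {n : ℕ} (Q : Set Plane) (P : Polygon Plane n) (v w : Plane) :
    Prop where
  ne : v ≠ w
  subset : segment ℝ v w ⊆ Q
  not_edge : ¬ IsPolygonEdge P v w
  inter_vertices : segment ℝ v w ∩ Set.range P.vertices = {v, w}

/-- The geometric simplicial complex `K` (nondegenerate simplices, any two of which meet in a common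
face or not at all) is a diagonal triangulation of the polygon `Q`: it consists of finitely many
triangles and their sides and corners, its underlying space is `Q`, and every side of a triangle is
an edge or a diagonal segment of the polygon. -/
structure IsDiagonalTriangulation {n : ℕ} (Q : Set Plane) (P : Polygon Plane n)
    (K : Geometry.SimplicialComplex ℝ Plane) : Prop where
  finite : K.faces.Finite
  space_eq : K.space = Q
  exists_triangle : ∀ s ∈ K.faces, ∃ t ∈ K.faces, s ⊆ t ∧ t.card = 3
  edges : ∀ t ∈ K.faces, ∀ v ∈ t, ∀ w ∈ t, v ≠ w →
    IsPolygonEdge P v w ∨ IsDiagonalSegment Q P v w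

/-!
A diagonal triangulation uses no points besides the vertices of the polygon, so an argument is
needed both for its existence and for the absence of very flat triangles.

*Existence.* Call a triangle with corners in the vertex set `V` *empty* if it contains no further
vertex, and consider families of empty triangles in `Q` with pairwise disjoint interiors
(`IsPacking`). Because the triangles and the edges of the polygon contain no vertices other than
their own, such triangles automatically fit together face to face (`segment_eq_side`,
`IsPacking.inter_subset`), and their sides are edges or diagonal segments. A largest packing covers
`Q`: what it leaves uncovered is an open set bounded by finitely many noncrossing segments
(`IsBarrier`), and such a set has room for another empty triangle
(`IsBarrier.exists_isEmptyTriangle`). To find that triangle, start with a corner at a point of the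
closure farthest from the origin and narrow it as long as its triangle contains further vertices.

*Angles.* Among the finitely many triangulations take one that minimizes
`∑ (area) * (sum of the squared norms of the corners)`. Comparison with the triangulation after a
flip gives the local Delaunay condition (`IsTriangulation.flip_inequality`). Suppose that the
triangle `abc` with longest side `ab` is very flat. Vertices have distance at least one, so `ab` is
not an edge (an edge has length one, and `abc` would be equilateral), and there is a triangle `abd`
on the other side of `ab`. As the angle at `c` is close to `π`, the Delaunay condition, or the
failure of the quadrilateral `adbc` to be convex, forces `abd` to be flat too, with an area larger
at most by a factor depending on `n`, and it forces the longest side of `abd` to be longer than `ab`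
(`IsTriangulation.exists_flatter`). Longest sides have at most `n ^ 2` lengths, so this can be
repeated at most `n ^ 2` times, which bounds the areas of all triangles below
(`IsTriangulation.le_doubleArea`). The diameter of `V` is bounded in terms of `n`, hence so are the
sines of the angles.
-/

open Set
open scoped Classical Topology

/-! ### Oriented area and triangles -/

/-- Twice the signed area of the triangle `a b c`; it is positive when `c` lies strictly to the
left of the directed line from `a` to `b`. -/
def orient (a b c : Plane) : ℝ := (b 0 - a 0) * (c 1 - a 1) - (b 1 - a 1) * (c 0 - a 0)

lemma orient_rotate (a b c : Plane) : orient b c a = orient a b c := by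
  simp only [orient]; ring

lemma orient_swap (a b c : Plane) : orient b a c = -orient a b c := by
  simp only [orient]; ring

lemma orient_swap_right (a b c : Plane) : orient a c b = -orient a b c := by
  simp only [orient]; ring

@[simp] lemma orient_self_left (a b : Plane) : orient a a b = 0 := by
  simp only [orient]; ring

@[simp] lemma orient_self_mid (a b : Plane) : orient a b b = 0 := by
  simp only [orient]; ring

@[simp] lemma orient_self_outer (a b : Plane) : orient a b a = 0 := by
  simp only [orient]; ring

/-- `orient a b` is an affine function of its last argument. -/
lemma orient_line (a b p q : Plane) (t : ℝ) :
    orient a b (p + t • (q - p)) = (1 - t) * orient a b p + t * orient a b q := by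
  simp only [orient, PiLp.add_apply, PiLp.smul_apply, PiLp.sub_apply, smul_eq_mul]; ring

lemma orient_add (a b c x : Plane) :
    orient a b x + orient b c x + orient c a x = orient a b c := by
  simp only [orient]; ring

/-- The barycentric coordinates of `x` in the triangle `a b c`. -/
lemma eq_barycentric {a b c : Plane} (h : orient a b c ≠ 0) (x : Plane) :
    x = (orient b c x / orient a b c) • a + (orient c a x / orient a b c) • b +
      (orient a b x / orient a b c) • c := by
  ext i
  have key : ∀ i : Fin 2, orient a b c * x i =
      orient b c x * a i + orient c a x * b i + orient a b x * c i := by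
    intro i
    fin_cases i <;> simp only [orient, Fin.zero_eta, Fin.mk_one, Fin.isValue] <;> ring
  have := key i
  simp only [PiLp.add_apply, PiLp.smul_apply, smul_eq_mul]
  field_simp
  linarith

lemma eq_of_orient_eq {a b c x y : Plane} (h : orient a b c ≠ 0)
    (h1 : orient a b x = orient a b y) (h2 : orient c a x = orient c a y) : x = y := by
  have h3 : orient b c x = orient b c y := by
    linarith [orient_add a b c x, orient_add a b c y]
  rw [eq_barycentric h x, eq_barycentric h y, h1, h2, h3]

lemma continuous_orient (a b : Plane) : Continuous (orient a b) := by
  unfold orient; fun_prop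

lemma convex_orient_nonneg (a b : Plane) : Convex ℝ {x | 0 ≤ orient a b x} := by
  intro x hx y hy s t hs ht hst
  have : orient a b (s • x + t • y) = s * orient a b x + t * orient a b y := by
    obtain rfl : s = 1 - t := by linarith
    rw [← orient_line]; congr 1; module
  simp only [mem_ofPred_eq] at *
  rw [this]; positivity

lemma mem_triangle {a b c : Plane} (h : 0 < orient a b c) {x : Plane} :
    x ∈ convexHull ℝ ({a, b, c} : Set Plane) ↔
      0 ≤ orient a b x ∧ 0 ≤ orient b c x ∧ 0 ≤ orient c a x := by
  constructor
  · intro hx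
    have hsub : convexHull ℝ ({a, b, c} : Set Plane) ⊆
        {x | 0 ≤ orient a b x} ∩ ({x | 0 ≤ orient b c x} ∩ {x | 0 ≤ orient c a x}) := by
      refine convexHull_min ?_ ((convex_orient_nonneg _ _).inter
        ((convex_orient_nonneg _ _).inter (convex_orient_nonneg _ _)))
      have h1 : orient b c a = orient a b c := orient_rotate a b c
      have h2 : orient c a b = orient a b c := by rw [orient_rotate b c a, h1]
      rintro y (rfl | rfl | rfl) <;> simp [h1, h2, h.le]
    exact hsub hx
  · rintro ⟨h1, h2, h3⟩
    rw [eq_barycentric h.ne' x]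
    have hs := orient_add a b c x
    have hc := convex_convexHull ℝ ({a, b, c} : Set Plane)
    have ha : a ∈ convexHull ℝ ({a, b, c} : Set Plane) := subset_convexHull _ _ (by simp)
    have hb : b ∈ convexHull ℝ ({a, b, c} : Set Plane) := subset_convexHull _ _ (by simp)
    have hc' : c ∈ convexHull ℝ ({a, b, c} : Set Plane) := subset_convexHull _ _ (by simp)
    have := hc.sum_mem (t := Finset.univ) (w := ![orient b c x / orient a b c,
      orient c a x / orient a b c, orient a b x / orient a b c]) (z := ![a, b, c])
      (by intro i _; fin_cases i <;> simp <;> positivity)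
      (by simp [Fin.sum_univ_three]; field_simp; linarith)
      (by intro i _; fin_cases i <;> simp [ha, hb, hc'])
    simpa [Fin.sum_univ_three] using this

lemma mem_interior_triangle {a b c : Plane} (h : 0 < orient a b c) {x : Plane} :
    x ∈ interior (convexHull ℝ ({a, b, c} : Set Plane)) ↔
      0 < orient a b x ∧ 0 < orient b c x ∧ 0 < orient c a x := by
  constructor
  · intro hx
    -- from an interior point one can move a little away from the opposite corner
    have key : ∀ p : Plane, ∃ s : ℝ, 0 < s ∧
        x + s • (x - p) ∈ convexHull ℝ ({a, b, c} : Set Plane) := by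
      intro p
      have hcont : Continuous fun s : ℝ => x + s • (x - p) := by fun_prop
      have h0 : (fun s : ℝ => x + s • (x - p)) 0 ∈
          interior (convexHull ℝ ({a, b, c} : Set Plane)) := by simpa using hx
      have := hcont.continuousAt.preimage_mem_nhds (isOpen_interior.mem_nhds h0)
      obtain ⟨ε, hε, hb⟩ := Metric.mem_nhds_iff.1 this
      refine ⟨ε / 2, by positivity, interior_subset (hb ?_)⟩
      simp [abs_of_pos hε, hε]
    have hl : ∀ a b p : Plane, ∀ s : ℝ,
        orient a b (x + s • (x - p)) = (1 + s) * orient a b x - s * orient a b p := by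
      intro a b p s
      simp only [orient, PiLp.add_apply, PiLp.smul_apply, PiLp.sub_apply, smul_eq_mul]; ring
    have h1 : orient b c a = orient a b c := orient_rotate a b c
    have h2 : orient c a b = orient a b c := by rw [orient_rotate b c a, h1]
    refine ⟨?_, ?_, ?_⟩
    · obtain ⟨s, hs, hm⟩ := key c
      have := ((mem_triangle h).1 hm).1
      rw [hl] at this
      by_contra! hn
      nlinarith [mul_pos hs h]
    · obtain ⟨s, hs, hm⟩ := key a
      have := ((mem_triangle h).1 hm).2.1
      rw [hl, h1] at this
      by_contra! hn
      nlinarith [mul_pos hs h]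
    · obtain ⟨s, hs, hm⟩ := key b
      have := ((mem_triangle h).1 hm).2.2
      rw [hl, h2] at this
      by_contra! hn
      nlinarith [mul_pos hs h]
  · rintro ⟨h1, h2, h3⟩
    refine mem_interior.2 ⟨{x | 0 < orient a b x} ∩ ({x | 0 < orient b c x} ∩
      {x | 0 < orient c a x}), ?_, ?_, h1, h2, h3⟩
    · rintro y ⟨h1, h2, h3⟩
      exact (mem_triangle h).2 ⟨le_of_lt h1, le_of_lt h2, le_of_lt h3⟩
    · exact (isOpen_lt continuous_const (continuous_orient _ _)).inter
        ((isOpen_lt continuous_const (continuous_orient _ _)).inter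
          (isOpen_lt continuous_const (continuous_orient _ _)))

lemma affineIndependent_of_orient {a b c : Plane} (h : orient a b c ≠ 0) :
    AffineIndependent ℝ ![a, b, c] := by
  rw [affineIndependent_iff_not_collinear_set, collinear_iff_of_mem (p₀ := a) (by simp)]
  rintro ⟨v, hv⟩
  obtain ⟨r, rfl⟩ := hv b (by simp)
  obtain ⟨s, rfl⟩ := hv c (by simp)
  apply h
  simp [orient]; ring

lemma affineIndependent_coe_of_orient {a b c : Plane} (h : orient a b c ≠ 0) :
    AffineIndependent ℝ ((↑) : ({a, b, c} : Set Plane) → Plane) := by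
  have := (affineIndependent_of_orient h).range
  have hr : range ![a, b, c] = {a, b, c} := by
    ext x; simp [Matrix.range_cons]; tauto
  rwa [hr] at this

lemma ne_of_orient {a b c : Plane} (h : orient a b c ≠ 0) : a ≠ b ∧ b ≠ c ∧ a ≠ c := by
  refine ⟨?_, ?_, ?_⟩ <;> rintro rfl <;> simp at h

/-- A triangle is the closure of its interior. -/
lemma triangle_subset_closure_interior {a b c : Plane} (h : 0 < orient a b c) :
    convexHull ℝ ({a, b, c} : Set Plane) ⊆
      closure (interior (convexHull ℝ ({a, b, c} : Set Plane))) := by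
  have hne : (interior (convexHull ℝ ({a, b, c} : Set Plane))).Nonempty := by
    refine ⟨(1 / 3 : ℝ) • (a + b + c), (mem_interior_triangle h).2 ?_⟩
    simp only [orient, PiLp.add_apply, PiLp.smul_apply, smul_eq_mul] at h ⊢
    refine ⟨?_, ?_, ?_⟩ <;> linarith
  rw [(convex_convexHull ℝ _).closure_interior_eq_closure_of_nonempty_interior hne]
  exact subset_closure

/-! ### Empty triangles and segments that meet their sides -/

/-- `t` is the vertex set of a nondegenerate triangle with corners in `V` that contains no further
point of `V`. -/
structure IsEmptyTriangle (V t : Finset Plane) : Prop where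
  subset : t ⊆ V
  exists_orient : ∃ a b c, t = {a, b, c} ∧ 0 < orient a b c
  empty : ∀ x ∈ V, x ∈ convexHull ℝ (t : Set Plane) → x ∈ t

lemma eventually_mem_interior_triangle {a b c y z : Plane} (h : 0 < orient a b c)
    (hy : y ∈ openSegment ℝ a b) (hz : 0 < orient a b z) :
    ∀ᶠ s : ℝ in 𝓝[>] 0, y + s • (z - y) ∈ interior (convexHull ℝ ({a, b, c} : Set Plane)) := by
  rw [openSegment_eq_image'] at hy
  obtain ⟨τ, ⟨h0, h1⟩, rfl⟩ := hy
  have hD1 : orient b c a = orient a b c := orient_rotate a b c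
  have hD2 : orient c a b = orient a b c := by rw [orient_rotate b c a, hD1]
  have key : ∀ p q : Plane, 0 < orient p q (a + τ • (b - a)) → ∀ᶠ s : ℝ in 𝓝[>] 0,
      0 < orient p q ((a + τ • (b - a)) + s • (z - (a + τ • (b - a)))) := by
    intro p q hpq
    have hc : Continuous fun s : ℝ =>
        orient p q ((a + τ • (b - a)) + s • (z - (a + τ • (b - a)))) :=
      (continuous_orient p q).comp (by fun_prop)
    have := (hc.tendsto 0).eventually_const_lt (u := 0) (by simpa using hpq)
    exact this.filter_mono nhdsWithin_le_nhds
  filter_upwards [key b c (by rw [orient_line, hD1]; simp; nlinarith),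
    key c a (by rw [orient_line, hD2]; simp; nlinarith), self_mem_nhdsWithin] with s h2 h3 hs
  refine (mem_interior_triangle h).2 ⟨?_, h2, h3⟩
  rw [orient_line, orient_line]
  simp only [orient_self_outer, orient_self_mid]
  have : 0 < s := hs
  nlinarith [mul_pos this hz]

lemma IsEmptyTriangle.exists_third {V t : Finset Plane} (ht : IsEmptyTriangle V t) {p q : Plane}
    (hp : p ∈ t) (hq : q ∈ t) (hpq : p ≠ q) : ∃ r, t = {p, q, r} ∧ orient p q r ≠ 0 := by
  obtain ⟨a, b, c, rfl, h⟩ := ht.exists_orient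
  have h1 : orient b c a = orient a b c := orient_rotate a b c
  have h2 : orient c a b = orient a b c := by rw [orient_rotate b c a, h1]
  simp only [Finset.mem_insert, Finset.mem_singleton] at hp hq
  rcases hp with rfl | rfl | rfl <;> rcases hq with rfl | rfl | rfl <;>
    first
      | exact absurd rfl hpq
      | exact ⟨c, by ext; simp; try tauto, by first | exact h.ne' | (rw [orient_swap]; linarith)⟩
      | exact ⟨a, by ext; simp; try tauto, by
          first | (rw [h1]; exact h.ne') | (rw [orient_swap, h1]; linarith)⟩
      | exact ⟨b, by ext; simp; try tauto, by
          first | (rw [h2]; exact h.ne') | (rw [orient_swap, h2]; linarith)⟩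

/-- A side of a triangle can be directed so that the triangle lies to its left. -/
lemma IsEmptyTriangle.exists_third_pos {V t : Finset Plane} (ht : IsEmptyTriangle V t)
    {p q : Plane} (hp : p ∈ t) (hq : q ∈ t) (hpq : p ≠ q) :
    ∃ a b c, t = {a, b, c} ∧ 0 < orient a b c ∧ ((a = p ∧ b = q) ∨ (a = q ∧ b = p)) := by
  obtain ⟨r, hr, h⟩ := ht.exists_third hp hq hpq
  rcases h.lt_or_gt with h | h
  · exact ⟨q, p, r, by rw [hr]; ext; simp; tauto, by rw [orient_swap]; linarith, by simp⟩
  · exact ⟨p, q, r, hr, h, by simp⟩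

lemma coe_triple (a b c : Plane) :
    (({a, b, c} : Finset Plane) : Set Plane) = {a, b, c} := by simp

/-- A point of a triangle outside its interior lies on a side. -/
lemma IsEmptyTriangle.exists_side {V t : Finset Plane} (ht : IsEmptyTriangle V t) {x : Plane}
    (hx : x ∈ convexHull ℝ (t : Set Plane)) (hi : x ∉ interior (convexHull ℝ (t : Set Plane))) :
    ∃ a b c, t = {a, b, c} ∧ 0 < orient a b c ∧ x ∈ segment ℝ a b := by
  have key : ∀ a b c : Plane, 0 < orient a b c → orient a b x = 0 → 0 ≤ orient b c x →
      0 ≤ orient c a x → x ∈ segment ℝ a b := by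
    intro a b c h h0 h1 h2
    refine ⟨orient b c x / orient a b c, orient c a x / orient a b c, by positivity, by positivity,
      ?_, ?_⟩
    · have := orient_add a b c x
      field_simp; linarith
    · have := eq_barycentric h.ne' x
      rw [h0, zero_div, zero_smul, add_zero] at this
      exact this.symm
  obtain ⟨a, b, c, rfl, h⟩ := ht.exists_orient
  have hr : orient b c a = orient a b c := orient_rotate a b c
  have hr' : orient c a b = orient a b c := by rw [orient_rotate b c a, hr]
  rw [coe_triple] at hx hi
  rw [mem_triangle h] at hx
  rw [mem_interior_triangle h] at hi
  obtain ⟨h1, h2, h3⟩ := hx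
  rcases h1.eq_or_lt with h1' | h1'
  · exact ⟨a, b, c, rfl, h, key a b c h h1'.symm h2 h3⟩
  rcases h2.eq_or_lt with h2' | h2'
  · exact ⟨b, c, a, by ext; simp; tauto, by rwa [hr], key b c a (by rwa [hr]) h2'.symm h3 h1⟩
  rcases h3.eq_or_lt with h3' | h3'
  · exact ⟨c, a, b, by ext; simp; tauto, by rwa [hr'], key c a b (by rwa [hr']) h3'.symm h1 h2⟩
  · exact absurd ⟨h1', h2', h3'⟩ hi

/-- A segment between points of `V`, containing no further point of `V` and avoiding the interior
of an empty triangle, can share with a side of that triangle a point outside `V` only if it is that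
side: otherwise it would cross the side and run into the interior, or overlap with it and one of the
four endpoints would lie inside the other segment. -/
lemma segment_eq_side {V : Finset Plane} {a b c v w y : Plane}
    (ht : IsEmptyTriangle V {a, b, c}) (h : 0 < orient a b c) (hv : v ∈ V) (hw : w ∈ V)
    (hvw : ∀ x ∈ V, x ∈ segment ℝ v w → x = v ∨ x = w)
    (hd : Disjoint (segment ℝ v w) (interior (convexHull ℝ ({a, b, c} : Set Plane))))
    (hya : y ∈ segment ℝ a b) (hyv : y ∈ segment ℝ v w) (hy : y ∉ V) :
    (v = a ∧ w = b) ∨ (v = b ∧ w = a) := by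
  have haV : a ∈ V := ht.subset (by simp)
  have hbV : b ∈ V := ht.subset (by simp)
  have hya' : y ∈ openSegment ℝ a b := mem_openSegment_of_ne_left_right
    (by rintro rfl; exact hy haV) (by rintro rfl; exact hy hbV) hya
  have hside : ∀ z ∈ segment ℝ v w, orient a b z ≤ 0 := by
    intro z hz
    by_contra! hpos
    have h1 := eventually_mem_interior_triangle h hya' hpos
    have h2 : ∀ᶠ s : ℝ in 𝓝[>] 0, s < 1 :=
      (gt_mem_nhds one_pos).filter_mono nhdsWithin_le_nhds
    obtain ⟨s, ⟨hs1, hs2⟩, hs0⟩ := ((h1.and h2).and self_mem_nhdsWithin).exists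
    have hs0' : 0 < s := hs0
    refine disjoint_left.1 hd ((convex_segment v w).add_smul_sub_mem hyv hz ⟨hs0'.le, hs2.le⟩) hs1
  have hD2 : orient c a b = orient a b c := by rw [orient_rotate b c a, orient_rotate a b c]
  obtain ⟨τ, ⟨hτ0, hτ1⟩, hτ⟩ : y ∈ (fun θ : ℝ => a + θ • (b - a)) '' Ioo 0 1 := by
    rwa [← openSegment_eq_image']
  obtain ⟨σ, ⟨hσ0, hσ1⟩, hσ⟩ : y ∈ (fun θ : ℝ => v + θ • (w - v)) '' Ioo 0 1 := by
    rw [← openSegment_eq_image']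
    exact mem_openSegment_of_ne_left_right
      (by rintro rfl; exact hy hv) (by rintro rfl; exact hy hw) hyv
  simp only at hτ hσ
  have hv0 := hside v (left_mem_segment _ _ _)
  have hw0 := hside w (right_mem_segment _ _ _)
  have hy0 : orient a b y = 0 := by rw [← hτ, orient_line]; simp
  have hsum : (1 - σ) * orient a b v + σ * orient a b w = 0 := by rw [← orient_line, hσ, hy0]
  have hv0' : orient a b v = 0 := by nlinarith
  have hw0' : orient a b w = 0 := by nlinarith
  -- everything happens on the line `ab`, with affine coordinate `g`
  set g : Plane → ℝ := fun x => orient c a x / orient a b c with hg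
  have hga : g a = 0 := by simp [hg]
  have hgb : g b = 1 := by simp [hg, hD2, h.ne']
  have hgl : ∀ p q : Plane, ∀ t : ℝ, g (p + t • (q - p)) = (1 - t) * g p + t * g q := by
    intro p q t; simp only [hg, orient_line]; ring
  have hinj : ∀ x x', orient a b x = 0 → orient a b x' = 0 → g x = g x' → x = x' := by
    intro x x' hx hx' hxx
    refine eq_of_orient_eq h.ne' (hx.trans hx'.symm) ?_
    simpa [hg, div_left_inj' h.ne'] using hxx
  have hgy : g y = τ := by rw [← hτ, hgl, hga, hgb]; ring
  have hgy' : (1 - σ) * g v + σ * g w = τ := by rw [← hgl, hσ, hgy]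
  have hv01 : ∀ z ∈ V, orient a b z = 0 → 0 ≤ g z → g z ≤ 1 → z = a ∨ z = b := by
    intro z hz hz0 h0 h1
    have hzt : z ∈ segment ℝ a b := by
      have : z = a + g z • (b - a) := by
        refine hinj _ _ hz0 (by rw [orient_line]; simp) ?_
        rw [hgl, hga, hgb]; ring
      rw [this, segment_eq_image']
      exact ⟨_, ⟨h0, h1⟩, rfl⟩
    have := ht.empty z hz (segment_subset_convexHull (by simp) (by simp) hzt)
    simp only [Finset.mem_insert, Finset.mem_singleton] at this
    rcases this with h | h | h
    · exact Or.inl h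
    · exact Or.inr h
    · rw [h] at hz0; linarith
  have hab01 : ∀ z ∈ V, orient a b z = 0 → ∀ θ : ℝ, 0 ≤ θ → θ ≤ 1 →
      g z = (1 - θ) * g v + θ * g w → z = v ∨ z = w := by
    intro z hz hz0 θ h0 h1 hθ
    refine hvw z hz ?_
    rw [segment_eq_image']
    refine ⟨θ, ⟨h0, h1⟩, (hinj _ _ hz0 ?_ ?_).symm⟩
    · rw [orient_line, hv0', hw0']; ring
    · rw [hgl, hθ]
  have hne : g v ≠ g w := by
    intro he
    apply hy
    have : y = v := hinj _ _ hy0 hv0' (by rw [hgy, ← hgy', he]; ring)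
    rwa [this]
  have main : ∀ p q : Plane, p ∈ V → q ∈ V → orient a b p = 0 → orient a b q = 0 → g p < τ →
      τ < g q → (∀ z ∈ V, orient a b z = 0 → g p ≤ g z → g z ≤ g q → z = p ∨ z = q) →
      p = a ∧ q = b := by
    intro p q hp hq hp0 hq0 hpτ hqτ hz
    have e1 : p = a := by
      rcases le_or_gt 0 (g p) with h0 | h0
      · rcases hv01 p hp hp0 h0 (by linarith) with h | h
        · exact h
        · rw [h, hgb] at hpτ; linarith
      · rcases hz a haV (by simp) (by rw [hga]; linarith) (by rw [hga]; linarith) with h | h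
        · exact h.symm
        · rw [← h, hga] at hqτ; linarith
    have e2 : q = b := by
      rcases le_or_gt (g q) 1 with h0 | h0
      · rcases hv01 q hq hq0 (by linarith) h0 with h | h
        · rw [h, hga] at hqτ; linarith
        · exact h
      · rcases hz b hbV (by simp) (by rw [hgb]; linarith) (by rw [hgb]; linarith) with h | h
        · rw [← h, hgb] at hpτ; linarith
        · exact h.symm
    exact ⟨e1, e2⟩
  rcases hne.lt_or_gt with hlt | hlt
  · refine Or.inl (main v w hv hw hv0' hw0' (by nlinarith) (by nlinarith) ?_)
    intro z hz hz0 h1 h2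
    have hpos : 0 < g w - g v := by linarith
    exact hab01 z hz hz0 ((g z - g v) / (g w - g v)) (div_nonneg (by linarith) hpos.le)
      ((div_le_one hpos).2 (by linarith)) (by field_simp; ring)
  · refine Or.inr (And.symm (main w v hw hv hw0' hv0' (by nlinarith) (by nlinarith) ?_))
    intro z hz hz0 h1 h2
    have hpos : 0 < g v - g w := by linarith
    refine (hab01 z hz hz0 ((g v - g z) / (g v - g w)) (div_nonneg (by linarith) hpos.le)
      ((div_le_one hpos).2 (by linarith)) (by field_simp; ring)).symm

/-! ### Narrowing a corner of a region bounded by segments -/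

/-- `F` is a family of segments between points of the finite set `V`, none containing a further
point of `V` and any two of them equal or meeting only in `V`, which bounds the region `O`: the
frontier of `O` is covered by segments of `F`, and no segment of `F` enters `O`. -/
structure IsBarrier (V : Finset Plane) (F : Plane → Plane → Prop) (O : Set Plane) : Prop where
  left_mem : ∀ ⦃p q⦄, F p q → p ∈ V
  right_mem : ∀ ⦃p q⦄, F p q → q ∈ V
  empty : ∀ ⦃p q⦄, F p q → ∀ x ∈ V, x ∈ segment ℝ p q → x = p ∨ x = q
  disjoint : ∀ ⦃p q⦄, F p q → Disjoint (segment ℝ p q) O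
  frontier : ∀ x ∈ frontier O, ∃ p q, F p q ∧ x ∈ segment ℝ p q
  noncrossing : ∀ ⦃p q p' q'⦄, F p q → F p' q' → ∀ x, x ∈ segment ℝ p q → x ∈ segment ℝ p' q' →
    x ∉ V → segment ℝ p q = segment ℝ p' q'

/-- The region `O` fills the angle `u v w` near its apex `v`, and the arms `[v, u]`, `[v, w]`, whose
endpoints lie in `V`, contain no further point of `V` and are not crossed by segments of `F`. -/
structure IsClearCorner (V : Finset Plane) (F : Plane → Plane → Prop) (O : Set Plane)
    (v u w : Plane) : Prop where
  apex_mem : v ∈ V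
  left_mem : u ∈ V
  right_mem : w ∈ V
  pos : 0 < orient v u w
  left_empty : ∀ x ∈ V, x ∈ segment ℝ v u → x = v ∨ x = u
  right_empty : ∀ x ∈ V, x ∈ segment ℝ v w → x = v ∨ x = w
  left_noncrossing : ∀ p q, F p q → ∀ y ∈ segment ℝ p q, y ∈ openSegment ℝ v u →
    ∀ z ∈ segment ℝ p q, orient v u z = 0
  right_noncrossing : ∀ p q, F p q → ∀ y ∈ segment ℝ p q, y ∈ openSegment ℝ v w →
    ∀ z ∈ segment ℝ p q, orient w v z = 0
  near : ∃ ε : ℝ, 0 < ε ∧ ∀ α β : ℝ, 0 < α → 0 < β → α + β < ε →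
    v + α • (u - v) + β • (w - v) ∈ O

lemma IsPreconnected.subset_of_disjoint_frontier {X : Type*} [TopologicalSpace X]
    {s O : Set X} (hs : IsPreconnected s) (hne : (s ∩ O).Nonempty)
    (hd : Disjoint s (frontier O)) : s ⊆ O := by
  have hx : ∀ x ∈ s, x ∈ closure O → x ∈ interior O := fun x hxs hx => by
    by_contra hi
    exact disjoint_left.1 hd hxs ⟨hx, hi⟩
  refine (hs.subset_left_of_subset_union isOpen_interior isClosed_closure.isOpen_compl
    (disjoint_compl_right_iff_subset.2 interior_subset_closure) (fun x hxs => ?_) ?_).trans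
    interior_subset
  · by_cases h : x ∈ closure O
    · exact Or.inl (hx x hxs h)
    · exact Or.inr h
  · obtain ⟨x, hxs, hxO⟩ := hne
    exact ⟨x, hxs, hx x hxs (subset_closure hxO)⟩

lemma eq_corner_coords {v u w : Plane} (h : orient v u w ≠ 0) (x : Plane) :
    x = v + (orient w v x / orient v u w) • (u - v) + (orient v u x / orient v u w) • (w - v) := by
  have h1 := orient_add v u w x
  have h2 : orient u w x / orient v u w =
      1 - orient w v x / orient v u w - orient v u x / orient v u w := by
    field_simp; linarith
  conv_lhs => rw [eq_barycentric h x, h2]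
  module

lemma orient_corner_coords (v u w : Plane) (α β : ℝ) :
    orient w v (v + α • (u - v) + β • (w - v)) = α * orient v u w ∧
    orient v u (v + α • (u - v) + β • (w - v)) = β * orient v u w := by
  constructor <;>
  · simp only [orient, PiLp.add_apply, PiLp.smul_apply, PiLp.sub_apply, smul_eq_mul]; ring

section corner

variable {V : Finset Plane} {F : Plane → Plane → Prop} {O : Set Plane} {v u w : Plane}

/-- A segment of `F` cannot have a point `y` inside the angle of a corner if the part of the angle
below the parallel to `[u, w]` through `y` contains no point of `V` besides `v`: its lower end `p`
would be `v`, so that the segment starts inside `O`, or the segment would cross an arm. -/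
lemma IsClearCorner.false_of_endpoint (hF : IsBarrier V F O) (hc : IsClearCorner V F O v u w)
    {p q y : Plane} (hpq : F p q ∨ F q p) (hy : y ∈ segment ℝ p q)
    (hA : 0 < orient w v y) (hB : 0 < orient v u y)
    (hS : orient w v y + orient v u y < orient v u w)
    (hp : orient w v p + orient v u p ≤ orient w v y + orient v u y)
    (hV : 0 ≤ orient w v p → 0 ≤ orient v u p → p = v) : False := by
  have hdis : ∀ z ∈ segment ℝ p q, z ∉ O := by
    intro z hz
    rcases hpq with h | h
    · exact disjoint_left.1 (hF.disjoint h) hz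
    · exact disjoint_left.1 (hF.disjoint h) (by rwa [segment_symm])
  have hemp : ∀ x ∈ V, x ∈ segment ℝ p q → x = p ∨ x = q := by
    intro x hx hz
    rcases hpq with h | h
    · exact hF.empty h x hx hz
    · exact (hF.empty h x hx (by rwa [segment_symm])).symm
  have hcl : ∀ z ∈ segment ℝ p q, z ∈ openSegment ℝ v u → False := by
    intro z hz hzo
    rcases hpq with h | h
    · exact hB.ne' (hc.left_noncrossing p q h z hz hzo y hy)
    · exact hB.ne' (hc.left_noncrossing q p h z (by rwa [segment_symm]) hzo y
        (by rwa [segment_symm]))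
  have hcr : ∀ z ∈ segment ℝ p q, z ∈ openSegment ℝ v w → False := by
    intro z hz hzo
    rcases hpq with h | h
    · exact hA.ne' (hc.right_noncrossing p q h z hz hzo y hy)
    · exact hA.ne' (hc.right_noncrossing q p h z (by rwa [segment_symm]) hzo y
        (by rwa [segment_symm]))
  have hmem : ∀ s : ℝ, 0 ≤ s → s ≤ 1 → y + s • (p - y) ∈ segment ℝ p q := fun s h0 h1 =>
    (convex_segment p q).add_smul_sub_mem hy (left_mem_segment _ _ _) ⟨h0, h1⟩
  have hD := hc.pos
  by_cases hpv : p = v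
  · -- the segment runs from `v` to `y`, and its points near `v` lie in `O`
    obtain ⟨ε, hε, hO⟩ := hc.near
    set δ : ℝ := min ε 1 / 2 with hδ
    have hδ0 : 0 < δ := by positivity
    have hδ1 : δ < 1 := by have := min_le_right ε 1; simp only [hδ]; linarith
    have hδε : δ < ε := by have := min_le_left ε 1; simp only [hδ]; linarith
    refine hdis _ (hmem (1 - δ) (by linarith) (by linarith)) ?_
    have := hO (δ * (orient w v y / orient v u w)) (δ * (orient v u y / orient v u w))
      (by positivity) (by positivity) (by
        rw [← mul_add, ← add_div]
        have h1 : (orient w v y + orient v u y) / orient v u w < 1 := (div_lt_one hD).2 hS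
        nlinarith)
    convert this using 1
    rw [hpv]
    have h1 := eq_corner_coords hD.ne' y
    set α := orient w v y / orient v u w
    set β := orient v u y / orient v u w
    rw [h1]; module
  · have hneg : orient w v p < 0 ∨ orient v u p < 0 := by
      by_contra! h; exact hpv (hV h.1 h.2)
    have hexit : ∃ s : ℝ, 0 < s ∧ s < 1 ∧
        ((orient w v (y + s • (p - y)) = 0 ∧ 0 ≤ orient v u (y + s • (p - y))) ∨
         (orient v u (y + s • (p - y)) = 0 ∧ 0 ≤ orient w v (y + s • (p - y)))) := by
      simp only [orient_line]
      generalize orient w v p = a at *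
      generalize orient v u p = b at *
      generalize orient w v y = a' at *
      generalize orient v u y = b' at *
      have e1 : a < 0 → (0 < a' / (a' - a) ∧ a' / (a' - a) < 1 ∧
          (1 - a' / (a' - a)) * a' + a' / (a' - a) * a = 0) := by
        intro ha
        have h1 : 0 < a' - a := by linarith
        exact ⟨by positivity, (div_lt_one h1).2 (by linarith), by field_simp; ring⟩
      have e2 : b < 0 → (0 < b' / (b' - b) ∧ b' / (b' - b) < 1 ∧
          (1 - b' / (b' - b)) * b' + b' / (b' - b) * b = 0) := by
        intro ha
        have h1 : 0 < b' - b := by linarith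
        exact ⟨by positivity, (div_lt_one h1).2 (by linarith), by field_simp; ring⟩
      rcases lt_or_ge a 0 with ha | ha
      · obtain ⟨h1, h2, h3⟩ := e1 ha
        rcases le_or_gt 0 ((1 - a' / (a' - a)) * b' + a' / (a' - a) * b) with h4 | h4
        · exact ⟨_, h1, h2, Or.inl ⟨h3, h4⟩⟩
        · have hb : b < 0 := by by_contra! hb; nlinarith
          obtain ⟨k1, k2, k3⟩ := e2 hb
          have : b' / (b' - b) < a' / (a' - a) := by
            by_contra! hle; nlinarith
          exact ⟨_, k1, k2, Or.inr ⟨k3, by nlinarith⟩⟩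
      · have hb : b < 0 := hneg.resolve_left (by linarith)
        obtain ⟨k1, k2, k3⟩ := e2 hb
        exact ⟨_, k1, k2, Or.inr ⟨k3, by nlinarith⟩⟩
    obtain ⟨s, hs0, hs1, hz⟩ := hexit
    set z := y + s • (p - y) with hzdef
    have hzm : z ∈ segment ℝ p q := hmem s hs0.le hs1.le
    have hzS : orient w v z + orient v u z < orient v u w := by
      rw [hzdef, orient_line, orient_line]; nlinarith
    have hzc := eq_corner_coords hD.ne' z
    by_cases hzv : z = v
    · -- the segment would end at `v`, but then it points away from the angle
      have hvq : v = q := by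
        rcases hemp v hc.apex_mem (hzv ▸ hzm) with h | h
        · exact absurd h.symm hpv
        · exact h
      rw [segment_symm, segment_eq_image'] at hy
      obtain ⟨t, ⟨ht0, ht1⟩, rfl⟩ := hy
      rw [← hvq] at hA hB
      simp only [orient_line, orient_self_mid, orient_self_outer] at hA hB
      rcases hneg with h | h <;> nlinarith
    · rcases hz with ⟨h0, h1⟩ | ⟨h0, h1⟩
      · rw [h0, zero_div, zero_smul, add_zero] at hzc
        have h1' : orient v u z ≠ 0 := by
          intro h; apply hzv; rw [hzc, h]; simp
        refine hcr z hzm ?_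
        rw [hzc, openSegment_eq_image']
        refine ⟨_, ⟨div_pos (lt_of_le_of_ne h1 h1'.symm) hD, (div_lt_one hD).2 ?_⟩, rfl⟩
        linarith
      · rw [h0, zero_div, zero_smul, add_zero] at hzc
        have h1' : orient w v z ≠ 0 := by
          intro h; apply hzv; rw [hzc, h]; simp
        refine hcl z hzm ?_
        rw [hzc, openSegment_eq_image']
        refine ⟨_, ⟨div_pos (lt_of_le_of_ne h1 h1'.symm) hD, (div_lt_one hD).2 ?_⟩, rfl⟩
        linarith

lemma IsClearCorner.not_mem_segment (hF : IsBarrier V F O) (hc : IsClearCorner V F O v u w) {m : ℝ}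
    (hm : m ≤ orient v u w)
    (hV : ∀ z ∈ V, 0 ≤ orient w v z → 0 ≤ orient v u z → orient w v z + orient v u z < m → z = v)
    {p q y : Plane} (hpq : F p q) (hA : 0 < orient w v y) (hB : 0 < orient v u y)
    (hS : orient w v y + orient v u y < m) : y ∉ segment ℝ p q := by
  intro hy
  have hor : orient w v p + orient v u p ≤ orient w v y + orient v u y ∨
      orient w v q + orient v u q ≤ orient w v y + orient v u y := by
    by_contra! h
    have hy' := hy
    clear hV
    rw [segment_eq_image'] at hy'
    obtain ⟨t, ⟨ht0, ht1⟩, rfl⟩ := hy'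
    simp only [orient_line] at h
    nlinarith [mul_le_mul_of_nonneg_left h.1.le (sub_nonneg.2 ht1),
      mul_le_mul_of_nonneg_left h.2.le ht0]
  rcases hor with h | h
  · exact hc.false_of_endpoint hF (Or.inl hpq) hy hA hB (by linarith) h
      fun h1 h2 => hV p (hF.left_mem hpq) h1 h2 (by linarith)
  · exact hc.false_of_endpoint hF (Or.inr hpq) (by rwa [segment_symm]) hA hB (by linarith) h
      fun h1 h2 => hV q (hF.right_mem hpq) h1 h2 (by linarith)

lemma IsClearCorner.mem_triangle_iff (hc : IsClearCorner V F O v u w) {x : Plane} :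
    x ∈ convexHull ℝ ({v, u, w} : Set Plane) ↔
      0 ≤ orient w v x ∧ 0 ≤ orient v u x ∧ orient w v x + orient v u x ≤ orient v u w := by
  have := orient_add v u w x
  rw [mem_triangle hc.pos]
  constructor
  · rintro ⟨h1, h2, h3⟩; exact ⟨h3, h1, by linarith⟩
  · rintro ⟨h1, h2, h3⟩; exact ⟨h2, by linarith, h1⟩

lemma IsClearCorner.interior_subset (hF : IsBarrier V F O) (hc : IsClearCorner V F O v u w)
    (hV : ∀ z ∈ V, z ∈ convexHull ℝ ({v, u, w} : Set Plane) → z = v ∨ z = u ∨ z = w) :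
    interior (convexHull ℝ ({v, u, w} : Set Plane)) ⊆ O := by
  have hD := hc.pos
  have hDu : orient w v u = orient v u w := by rw [orient_rotate u w v, orient_rotate v u w]
  set I := interior (convexHull ℝ ({v, u, w} : Set Plane)) with hI
  have hpre : IsPreconnected I := (convex_convexHull ℝ _).interior.isPreconnected
  have hmeet : (I ∩ O).Nonempty := by
    obtain ⟨ε, hε, hO⟩ := hc.near
    set δ : ℝ := min ε 1 / 4 with hδ
    have hδ0 : 0 < δ := by positivity
    have hδ1 : 4 * δ ≤ 1 := by have := min_le_right ε 1; simp only [hδ]; linarith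
    have hδε : 4 * δ ≤ ε := by have := min_le_left ε 1; simp only [hδ]; linarith
    refine ⟨_, ?_, hO δ δ hδ0 hδ0 (by linarith)⟩
    obtain ⟨h1, h2⟩ := orient_corner_coords v u w δ δ
    have h3 := orient_add v u w (v + δ • (u - v) + δ • (w - v))
    refine (mem_interior_triangle hD).2 ⟨?_, ?_, ?_⟩
    · rw [h2]; positivity
    · nlinarith
    · rw [h1]; positivity
  refine hpre.subset_of_disjoint_frontier hmeet (disjoint_left.2 fun y hyI hyf => ?_)
  obtain ⟨p, q, hpq, hy⟩ := hF.frontier y hyf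
  obtain ⟨h1, h2, h3⟩ := (mem_interior_triangle hD).1 hyI
  have := orient_add v u w y
  refine hc.not_mem_segment hF le_rfl ?_ hpq h3 h1 (by linarith) hy
  intro z hz hz1 hz2 hz3
  rcases hV z hz (hc.mem_triangle_iff.2 ⟨hz1, hz2, hz3.le⟩) with h | h | h
  · exact h
  · subst h; rw [hDu] at hz3; linarith
  · subst h; linarith

/-- Every corner can be narrowed until its triangle contains no further point of `V`: as long as
there is one, replace an arm by the segment to the one closest to the apex, measured by the
parallels to the opposite side. -/
lemma IsClearCorner.exists_isEmptyTriangle (hF : IsBarrier V F O) (hc : IsClearCorner V F O v u w) :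
    ∃ t, IsEmptyTriangle V t ∧ interior (convexHull ℝ (t : Set Plane)) ⊆ O := by
  induction hn : (V.filter (· ∈ convexHull ℝ ({v, u, w} : Set Plane))).card
    using Nat.strong_induction_on generalizing w with
  | _ n ih =>
  have hD := hc.pos
  have hDu : orient w v u = orient v u w := by rw [orient_rotate u w v, orient_rotate v u w]
  by_cases hV : ∀ z ∈ V, z ∈ convexHull ℝ ({v, u, w} : Set Plane) → z = v ∨ z = u ∨ z = w
  · refine ⟨{v, u, w}, ⟨?_, ⟨v, u, w, rfl, hD⟩, ?_⟩, ?_⟩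
    · intro x hx
      simp only [Finset.mem_insert, Finset.mem_singleton] at hx
      rcases hx with rfl | rfl | rfl
      exacts [hc.apex_mem, hc.left_mem, hc.right_mem]
    · intro x hx hxt
      rw [coe_triple] at hxt
      simpa using hV x hx hxt
    · rw [coe_triple]; exact hc.interior_subset hF hV
  · set Z := V.filter (fun z => z ∈ convexHull ℝ ({v, u, w} : Set Plane) ∧
      ¬ (z = v ∨ z = u ∨ z = w)) with hZ
    have hZne : Z.Nonempty := by
      push Not at hV
      obtain ⟨z, hz, h1, h2⟩ := hV
      exact ⟨z, Finset.mem_filter.2 ⟨hz, h1, by tauto⟩⟩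
    obtain ⟨z, hzZ, hmin⟩ := Z.exists_min_image (fun z => orient w v z + orient v u z) hZne
    obtain ⟨hzV, hzt, hzn⟩ := Finset.mem_filter.1 hzZ
    obtain ⟨hz1, hz2, hz3⟩ := hc.mem_triangle_iff.1 hzt
    have hzc := eq_corner_coords hD.ne' z
    have hA : 0 < orient w v z := by
      refine lt_of_le_of_ne hz1 fun h => hzn ?_
      rw [← h, zero_div, zero_smul, add_zero] at hzc
      have : z ∈ segment ℝ v w := by
        rw [segment_eq_image']
        exact ⟨_, ⟨by positivity, (div_le_one hD).2 (by linarith)⟩, hzc.symm⟩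
      rcases hc.right_empty z hzV this with h | h <;> simp [h]
    have hB : 0 < orient v u z := by
      refine lt_of_le_of_ne hz2 fun h => hzn ?_
      rw [← h, zero_div, zero_smul, add_zero] at hzc
      have : z ∈ segment ℝ v u := by
        rw [segment_eq_image']
        exact ⟨_, ⟨by positivity, (div_le_one hD).2 (by linarith)⟩, hzc.symm⟩
      rcases hc.left_empty z hzV this with h | h <;> simp [h]
    have hbelow : ∀ z' ∈ V, 0 ≤ orient w v z' → 0 ≤ orient v u z' →
        orient w v z' + orient v u z' < orient w v z + orient v u z → z' = v := by
      intro z' hz' h1 h2 h3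
      by_contra hne
      have hmem := hc.mem_triangle_iff.2 ⟨h1, h2, by linarith⟩
      by_cases h : z' = v ∨ z' = u ∨ z' = w
      · rcases h with h | h | h
        · exact hne h
        · subst h; rw [hDu] at h3; simp only [orient_self_mid] at h3; linarith
        · subst h; simp only [orient_self_outer] at h3; linarith
      · have := hmin z' (Finset.mem_filter.2 ⟨hz', hmem, h⟩)
        linarith
    have hline : ∀ t : ℝ, orient w v (v + t • (z - v)) = t * orient w v z ∧
        orient v u (v + t • (z - v)) = t * orient v u z := by
      intro t; simp [orient_line]
    have hc' : IsClearCorner V F O v u z := by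
      refine ⟨hc.apex_mem, hc.left_mem, hzV, hB, hc.left_empty, ?_, hc.left_noncrossing, ?_, ?_⟩
      · intro x hx hxs
        rw [segment_eq_image'] at hxs
        obtain ⟨t, ⟨ht0, ht1⟩, rfl⟩ := hxs
        rcases ht1.eq_or_lt with rfl | ht1
        · right; simp
        · left
          refine hbelow _ hx ?_ ?_ ?_
          · rw [(hline t).1]; positivity
          · rw [(hline t).2]; positivity
          · rw [(hline t).1, (hline t).2]; nlinarith
      · intro p q hpq y hy hyo
        rw [openSegment_eq_image'] at hyo
        obtain ⟨t, ⟨ht0, ht1⟩, rfl⟩ := hyo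
        refine absurd hy (hc.not_mem_segment hF hz3 hbelow hpq ?_ ?_ ?_)
        · rw [(hline t).1]; positivity
        · rw [(hline t).2]; positivity
        · rw [(hline t).1, (hline t).2]; nlinarith
      · obtain ⟨ε, hε, hO⟩ := hc.near
        refine ⟨ε, hε, fun α β hα hβ hαβ => ?_⟩
        have := hO (α + β * (orient w v z / orient v u w)) (β * (orient v u z / orient v u w))
          (by positivity) (by positivity) (by
            have : (orient w v z + orient v u z) / orient v u w ≤ 1 := (div_le_one hD).2 hz3
            rw [add_div] at this
            nlinarith)
        convert this using 1
        set a := orient w v z / orient v u w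
        set b := orient v u z / orient v u w
        rw [hzc]; module
    refine ih _ ?_ hc' rfl
    rw [← hn]
    refine Finset.card_lt_card ((Finset.ssubset_iff_of_subset ?_).2 ⟨w, ?_, ?_⟩)
    · intro x hx
      rw [Finset.mem_filter] at hx ⊢
      refine ⟨hx.1, convexHull_min ?_ (convex_convexHull ℝ _) hx.2⟩
      rintro y (rfl | rfl | rfl)
      · exact subset_convexHull _ _ (by simp)
      · exact subset_convexHull _ _ (by simp)
      · exact hzt
    · exact Finset.mem_filter.2 ⟨hc.right_mem, subset_convexHull _ _ (by simp)⟩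
    · intro hw
      have := (hc'.mem_triangle_iff.1 (Finset.mem_filter.1 hw).2).1
      have h2 : orient z v w = -orient w v z := by
        simp only [orient]; ring
      linarith

end corner

/-! ### Existence of corners -/

/-- Walking from a point of a bounded open set in a fixed direction, one leaves it through a first
frontier point. -/
lemma exists_exit {O : Set Plane} (hO : IsOpen O) (hb : Bornology.IsBounded O) {x e : Plane}
    (hx : x ∈ O) (he : e ≠ 0) :
    ∃ t : ℝ, 0 < t ∧ x + t • e ∈ frontier O ∧ ∀ s : ℝ, 0 ≤ s → s < t → x + s • e ∈ O := by
  set S : Set ℝ := {t | 0 ≤ t ∧ x + t • e ∉ O} with hS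
  have hcont : Continuous fun t : ℝ => x + t • e := by fun_prop
  have hclosed : IsClosed S :=
    isClosed_Ici.inter (hO.isClosed_compl.preimage hcont)
  have hne : S.Nonempty := by
    obtain ⟨C, hC⟩ := hb.exists_norm_le
    have hpos : 0 < ‖e‖ := norm_pos_iff.2 he
    have hx' := hC x hx
    have hC0 : 0 ≤ C := (norm_nonneg x).trans hx'
    refine ⟨(2 * C + 1) / ‖e‖, by positivity, fun h => ?_⟩
    have h1 := hC _ h
    have h2 : ‖((2 * C + 1) / ‖e‖) • e‖ = 2 * C + 1 := by
      rw [norm_smul, Real.norm_of_nonneg (by positivity)]; field_simp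
    have h3 := norm_sub_le (x + ((2 * C + 1) / ‖e‖) • e) x
    rw [add_sub_cancel_left, h2] at h3
    linarith
  have hbdd : BddBelow S := ⟨0, fun t ht => ht.1⟩
  have hmem := hclosed.csInf_mem hne hbdd
  set t := sInf S
  have hlt : ∀ s : ℝ, 0 ≤ s → s < t → x + s • e ∈ O := by
    intro s hs hst
    by_contra h
    exact absurd (csInf_le hbdd ⟨hs, h⟩) (not_le.2 hst)
  have ht : 0 < t := by
    refine lt_of_le_of_ne hmem.1 fun h => hmem.2 ?_
    rw [← h]; simpa using hx
  refine ⟨t, ht, ?_, hlt⟩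
  rw [hO.frontier_eq]
  refine ⟨?_, hmem.2⟩
  have h1 : Filter.Tendsto (fun s : ℝ => x + s • e) (𝓝[<] t) (𝓝 (x + t • e)) :=
    (hcont.tendsto t).mono_left nhdsWithin_le_nhds
  refine mem_closure_of_tendsto h1 ?_
  filter_upwards [Ioo_mem_nhdsLT ht] with s hs
  exact hlt s hs.1.le hs.2

lemma orient_eq_zero_of_mem_segment {p q a b c : Plane} (ha : a ∈ segment ℝ p q)
    (hb : b ∈ segment ℝ p q) (hc : c ∈ segment ℝ p q) : orient a b c = 0 := by
  rw [segment_eq_image'] at ha hb hc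
  obtain ⟨r, -, rfl⟩ := ha
  obtain ⟨s, -, rfl⟩ := hb
  obtain ⟨t, -, rfl⟩ := hc
  simp only [orient, PiLp.add_apply, PiLp.smul_apply, PiLp.sub_apply, smul_eq_mul]; ring

lemma isClosed_segment (p q : Plane) : IsClosed (segment ℝ p q) := by
  rw [← convexHull_pair]
  exact (((Set.finite_singleton q).insert p).isCompact_convexHull ℝ).isClosed

/-- Near a point `v` there are no points of `V` except possibly `v`, and no segments of `F` except
those through `v`. -/
lemma IsBarrier.exists_ball {V : Finset Plane} {F : Plane → Plane → Prop} {O : Set Plane}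
    (hF : IsBarrier V F O) (v : Plane) :
    ∃ r : ℝ, 0 < r ∧ (∀ x ∈ V, x ∈ Metric.ball v r → x = v) ∧
      ∀ p q, F p q → ∀ x ∈ segment ℝ p q, x ∈ Metric.ball v r → v ∈ segment ℝ p q := by
  set C : Set Plane := (↑(V.erase v) : Set Plane) ∪
    ⋃ pq ∈ ((V ×ˢ V).filter fun pq => v ∉ segment ℝ pq.1 pq.2), segment ℝ pq.1 pq.2 with hC
  have hclosed : IsClosed C := by
    refine (Finset.finite_toSet _).isClosed.union ?_
    exact (Finset.finite_toSet _).isClosed_biUnion fun pq _ => isClosed_segment _ _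
  have hv : v ∈ Cᶜ := by
    simp only [hC, mem_compl_iff, mem_union, Finset.mem_coe, Finset.mem_erase, mem_iUnion,
      Finset.mem_filter, not_or]
    refine ⟨fun h => h.1 rfl, ?_⟩
    rintro ⟨pq, h, h'⟩
    exact h.2 h'
  obtain ⟨r, hr, hsub⟩ := Metric.isOpen_iff.1 hclosed.isOpen_compl v hv
  refine ⟨r, hr, fun x hx hxr => ?_, fun p q hpq x hx hxr => ?_⟩
  · by_contra hne
    exact hsub hxr (Or.inl (by simp [hne, hx]))
  · by_contra hne
    refine hsub hxr (Or.inr ?_)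
    simp only [mem_iUnion, Finset.mem_filter]
    exact ⟨(p, q), ⟨Finset.mk_mem_product (hF.left_mem hpq) (hF.right_mem hpq), hne⟩, hx⟩

lemma inner_plane (x y : Plane) : inner ℝ x y = x 0 * y 0 + x 1 * y 1 := by
  simp [PiLp.inner_apply, Fin.sum_univ_two]; ring

/-- A bounded open set has arbitrarily short chords near a suitable point `v`, namely a point of its
closure farthest from the origin: take chords perpendicular to the direction of `v`. -/
lemma exists_short_chord {O : Set Plane} (hO : IsOpen O) (hb : Bornology.IsBounded O)
    (hne : O.Nonempty) : ∃ v, ∀ r : ℝ, 0 < r → ∃ y₁ y₂, y₁ ∈ frontier O ∧ y₂ ∈ frontier O ∧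
      y₁ ∈ Metric.ball v r ∧ y₂ ∈ Metric.ball v r ∧ 0 < orient v y₁ y₂ ∧
      openSegment ℝ y₁ y₂ ⊆ O := by
  obtain ⟨v, hvO, hmax⟩ := hb.isCompact_closure.exists_isMaxOn hne.closure
    continuous_norm.continuousOn
  have hmax' : ∀ x ∈ closure O, ‖x‖ ≤ ‖v‖ := fun x hx => hmax hx
  have hv0 : 0 < ‖v‖ := by
    obtain ⟨x, hx, hx0⟩ := (dense_compl_singleton (0 : Plane)).inter_open_nonempty O hO hne
    exact (norm_pos_iff.2 hx0).trans_le (hmax' x (subset_closure hx))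
  have hvnO : v ∉ O := by
    intro hv
    have hcont : Continuous fun s : ℝ => v + s • v := by fun_prop
    have h1 : ∀ᶠ s : ℝ in 𝓝[>] 0, v + s • v ∈ O :=
      ((hcont.tendsto 0).eventually (hO.mem_nhds (by simpa using hv))).filter_mono
        nhdsWithin_le_nhds
    obtain ⟨s, hs, hs0⟩ := (h1.and self_mem_nhdsWithin).exists
    have hs0' : 0 < s := hs0
    have h2 := hmax' _ (subset_closure hs)
    have h3 : v + s • v = (1 + s) • v := by module
    rw [h3, norm_smul, Real.norm_of_nonneg (by positivity)] at h2
    nlinarith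
  refine ⟨v, fun r hr => ?_⟩
  obtain ⟨x, hxO, hxv⟩ := Metric.mem_closure_iff.1 hvO (r ^ 2 / (2 * ‖v‖)) (by positivity)
  have hxn := hmax' x (subset_closure hxO)
  have hxne : x ≠ v := by rintro rfl; exact hvnO hxO
  have hin : inner ℝ x v < ‖v‖ ^ 2 := by
    have h1 := norm_sub_sq_real x v
    have h2 : 0 < ‖x - v‖ := norm_pos_iff.2 (sub_ne_zero.2 hxne)
    nlinarith [norm_nonneg x]
  have hnear : ∀ y ∈ closure O, inner ℝ y v = inner ℝ x v → y ∈ Metric.ball v r := by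
    intro y hy hyx
    have h1 := norm_sub_sq_real y v
    have h2 := hmax' y hy
    have h3 : inner ℝ (v - x) v ≤ ‖v - x‖ * ‖v‖ := real_inner_le_norm _ _
    rw [inner_sub_left, real_inner_self_eq_norm_sq] at h3
    rw [dist_eq_norm] at hxv
    rw [lt_div_iff₀ (by positivity)] at hxv
    rw [Metric.mem_ball, dist_eq_norm]
    refine lt_of_pow_lt_pow_left₀ 2 hr.le ?_
    nlinarith [norm_nonneg y]
  set e : Plane := !₂[-v 1, v 0] with he
  have he0 : e 0 = -v 1 := by simp [he]
  have he1 : e 1 = v 0 := by simp [he]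
  have hene : e ≠ 0 := by
    intro h
    have h1 : v 1 = 0 := by have : e 0 = 0 := by rw [h]; rfl
                            linarith
    have h0 : v 0 = 0 := by have : e 1 = 0 := by rw [h]; rfl
                            linarith
    apply hv0.ne'
    rw [EuclideanSpace.norm_eq]
    simp [Fin.sum_univ_two, h0, h1]
  have hev : ∀ s : ℝ, inner ℝ (x + s • e) v = inner ℝ x v := by
    intro s
    rw [inner_plane, inner_plane]
    simp only [PiLp.add_apply, PiLp.smul_apply, smul_eq_mul, he0, he1]; ring
  obtain ⟨t₁, ht₁, hy₁f, hO₁⟩ := exists_exit hO hb hxO hene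
  obtain ⟨t₂, ht₂, hy₂f, hO₂⟩ := exists_exit hO hb hxO (neg_ne_zero.2 hene)
  have hchord : ∀ s : ℝ, -t₂ < s → s < t₁ → x + s • e ∈ O := by
    intro s h1 h2
    rcases le_or_gt 0 s with h | h
    · exact hO₁ s h h2
    · have := hO₂ (-s) (by linarith) (by linarith)
      rwa [smul_neg, neg_smul, neg_neg] at this
  have hy₂eq : x + t₂ • -e = x + (-t₂) • e := by module
  rw [hy₂eq] at hy₂f
  set y₁ := x + t₁ • e with hy₁
  set y₂ := x + (-t₂) • e with hy₂
  have hy₁b : y₁ ∈ Metric.ball v r := hnear _ (frontier_subset_closure hy₁f) (hev _)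
  have hy₂b : y₂ ∈ Metric.ball v r := hnear _ (frontier_subset_closure hy₂f) (hev _)
  have hpos : 0 < orient v y₁ y₂ := by
    have h1 : orient v y₁ y₂ = (t₁ + t₂) * (‖v‖ ^ 2 - inner ℝ x v) := by
      rw [← real_inner_self_eq_norm_sq, inner_plane, inner_plane]
      simp only [orient, hy₁, hy₂, PiLp.add_apply, PiLp.smul_apply, smul_eq_mul, he0, he1]
      ring
    rw [h1]
    exact mul_pos (by linarith) (by linarith)
  refine ⟨y₁, y₂, hy₁f, hy₂f, hy₁b, hy₂b, hpos, ?_⟩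
  rw [openSegment_eq_image']
  rintro _ ⟨θ, ⟨hθ0, hθ1⟩, rfl⟩
  have : y₁ + θ • (y₂ - y₁) = x + (t₁ - θ * (t₁ + t₂)) • e := by rw [hy₁, hy₂]; module
  simp only [this]
  exact hchord _ (by nlinarith) (by nlinarith)

section ball

variable {V : Finset Plane} {F : Plane → Plane → Prop} {O : Set Plane} {v : Plane} {r : ℝ}

/-- The segments of `F` near a point `v` of `V` emanate from `v`. -/
lemma IsBarrier.exists_arm (hF : IsBarrier V F O) (hvV : v ∈ V)
    (hrF : ∀ p q, F p q → ∀ x ∈ segment ℝ p q, x ∈ Metric.ball v r → v ∈ segment ℝ p q)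
    {y p q : Plane} (hyv : y ≠ v) (hyb : y ∈ Metric.ball v r) (hpq : F p q)
    (hy : y ∈ segment ℝ p q) :
    ∃ u ∈ V, segment ℝ p q = segment ℝ v u ∧ (∀ z ∈ V, z ∈ segment ℝ v u → z = v ∨ z = u) ∧
      ∃ a : ℝ, 0 < a ∧ a ≤ 1 ∧ y = v + a • (u - v) := by
  have hvs := hrF _ _ hpq _ hy hyb
  have key : ∀ u, segment ℝ p q = segment ℝ v u →
      ∃ a : ℝ, 0 < a ∧ a ≤ 1 ∧ y = v + a • (u - v) := by
    intro u hu
    rw [hu, segment_eq_image'] at hy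
    obtain ⟨a, ⟨ha0, ha1⟩, rfl⟩ := hy
    refine ⟨a, lt_of_le_of_ne ha0 ?_, ha1, rfl⟩
    rintro rfl; simp at hyv
  have hemp := hF.empty hpq
  rcases hemp v hvV hvs with h | h
  · subst h
    exact ⟨q, hF.right_mem hpq, rfl, hemp, key q rfl⟩
  · subst h
    exact ⟨p, hF.left_mem hpq, segment_symm _ _ _,
      fun z hz hz' => (hemp z hz (by rwa [segment_symm])).symm, key p (segment_symm _ _ _)⟩

/-- The triangle cut off by a chord near `v` lies in the region: a segment of `F` inside it would
start at `v` and have to cross the chord or end near `v`. -/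
lemma IsBarrier.interior_triangle_subset (hF : IsBarrier V F O) (hO : IsOpen O) (hvV : v ∈ V)
    (hr : 0 < r) (hrV : ∀ x ∈ V, x ∈ Metric.ball v r → x = v)
    (hrF : ∀ p q, F p q → ∀ x ∈ segment ℝ p q, x ∈ Metric.ball v r → v ∈ segment ℝ p q)
    {y₁ y₂ : Plane} (hy₁b : y₁ ∈ Metric.ball v r) (hy₂b : y₂ ∈ Metric.ball v r)
    (hpos : 0 < orient v y₁ y₂) (hchord : openSegment ℝ y₁ y₂ ⊆ O) :
    interior (convexHull ℝ ({v, y₁, y₂} : Set Plane)) ⊆ O := by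
  have hball : convexHull ℝ ({v, y₁, y₂} : Set Plane) ⊆ Metric.ball v r := by
    refine convexHull_min ?_ (convex_ball v r)
    rintro z (rfl | rfl | rfl)
    exacts [Metric.mem_ball_self hr, hy₁b, hy₂b]
  refine (convex_convexHull ℝ _).interior.isPreconnected.subset_of_disjoint_frontier ?_ ?_
  · obtain ⟨x, hxseg⟩ : (openSegment ℝ y₁ y₂).Nonempty := by
      rw [openSegment_eq_image']
      exact ⟨_, 1 / 2, by norm_num, rfl⟩
    have hxO := hchord hxseg
    have hrot : orient y₁ y₂ v = orient v y₁ y₂ := orient_rotate _ _ _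
    have h1 := eventually_mem_interior_triangle (c := v) (z := v) (by rwa [hrot]) hxseg
      (by rwa [hrot])
    have hset : ({y₁, y₂, v} : Set Plane) = {v, y₁, y₂} := by ext; simp; tauto
    rw [hset] at h1
    have hcont : Continuous fun s : ℝ => x + s • (v - x) := by fun_prop
    have h2 : ∀ᶠ s : ℝ in 𝓝[>] 0, x + s • (v - x) ∈ O :=
      ((hcont.tendsto 0).eventually (hO.mem_nhds (by simpa using hxO))).filter_mono
        nhdsWithin_le_nhds
    obtain ⟨s, hs⟩ := (h1.and h2).exists
    exact ⟨_, hs⟩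
  · refine disjoint_left.2 fun z hz hzf => ?_
    obtain ⟨p, q, hpq, hzs⟩ := hF.frontier z hzf
    have hdis := hF.disjoint hpq
    obtain ⟨k1, k2, k3⟩ := (mem_interior_triangle hpos).1 hz
    have hzv : z ≠ v := by rintro rfl; simp at k1
    obtain ⟨u, huV, hseg, -, a, ha0, ha1, hza⟩ := 
      hF.exists_arm hvV hrF hzv (hball (interior_subset hz)) hpq hzs
    rw [hseg] at hdis
    have hadd := orient_add v y₁ y₂ z
    set D := orient v y₁ y₂ with hD
    set S := orient v y₁ z + orient y₂ v z with hS
    have hS0 : 0 < S := by positivity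
    have hSD : S < D := by linarith
    have hline : ∀ c : ℝ, orient v y₁ (v + c • (z - v)) = c * orient v y₁ z ∧
        orient y₂ v (v + c • (z - v)) = c * orient y₂ v z := by
      intro c; simp [orient_line]
    have hz' : v + (D / S) • (z - v) ∈ O := by
      obtain ⟨l1, l2⟩ := hline (D / S)
      have l3 := orient_add v y₁ y₂ (v + (D / S) • (z - v))
      have l4 : D / S * orient v y₁ z + D / S * orient y₂ v z = D := by
        rw [← mul_add, ← hS]; exact div_mul_cancel₀ _ hS0.ne'
      have l5 : orient y₁ y₂ (v + (D / S) • (z - v)) = 0 := by linarith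
      have := eq_barycentric hpos.ne' (v + (D / S) • (z - v))
      rw [← hD, l5, l1, l2, zero_div, zero_smul, zero_add] at this
      have l6 : D / S * orient y₂ v z / D = 1 - D / S * orient v y₁ z / D := by
        have : D ≠ 0 := hpos.ne'
        field_simp; linarith
      set θ := D / S * orient v y₁ z / D with hθ
      have hθ0 : 0 < θ := by positivity
      have hθ1 : 0 < 1 - θ := by rw [← l6]; positivity
      have l7 : v + (D / S) • (z - v) = y₁ + θ • (y₂ - y₁) := by
        rw [this, l6]; module
      rw [l7]
      refine hchord ?_
      rw [openSegment_eq_image']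
      exact ⟨θ, ⟨hθ0, by linarith⟩, rfl⟩
    have hDS : 1 < D / S := (one_lt_div hS0).2 hSD
    have hzu : ∀ c : ℝ, v + c • (z - v) = v + (c * a) • (u - v) := by
      intro c; conv_lhs => rw [hza]
      module
    rcases le_or_gt (D / S * a) 1 with hle | hgt
    · refine disjoint_left.1 hdis ?_ hz'
      rw [hzu, segment_eq_image']
      exact ⟨_, ⟨by positivity, hle⟩, rfl⟩
    · -- the segment would end inside the triangle, too close to `v`
      have hu : u = v + (1 / a) • (z - v) := by
        rw [hzu, one_div_mul_cancel ha0.ne']; module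
      have hlt : 1 / a < D / S := (div_lt_iff₀ ha0).2 hgt
      have : 1 / a * S < D := by rwa [lt_div_iff₀ hS0] at hlt
      have hut : u ∈ convexHull ℝ ({v, y₁, y₂} : Set Plane) := by
        obtain ⟨l1, l2⟩ := hline (1 / a)
        have l3 := orient_add v y₁ y₂ (v + (1 / a) • (z - v))
        rw [← hu] at l1 l2 l3
        refine (mem_triangle hpos).2 ⟨?_, ?_, ?_⟩
        · rw [l1]; positivity
        · have : 1 / a * S = 1 / a * orient v y₁ z + 1 / a * orient y₂ v z := by
            rw [hS]; ring
          linarith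
        · rw [l2]; positivity
      have huv := hrV u huV (hball hut)
      apply hzv
      rw [hza, huv]; simp

end ball

/-- A short chord near a suitable point `v` ends on two segments of `F` through `v`, so that `v`
belongs to `V` and is the apex of a corner. -/
lemma IsBarrier.exists_isClearCorner {V : Finset Plane} {F : Plane → Plane → Prop} {O : Set Plane}
    (hF : IsBarrier V F O) (hO : IsOpen O) (hb : Bornology.IsBounded O) (hne : O.Nonempty) :
    ∃ v u w, IsClearCorner V F O v u w := by
  obtain ⟨v, hv⟩ := exists_short_chord hO hb hne
  obtain ⟨r, hr, hrV, hrF⟩ := hF.exists_ball v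
  obtain ⟨y₁, y₂, hy₁f, hy₂f, hy₁b, hy₂b, hpos, hchord⟩ := hv r hr
  have hvV : v ∈ V := by
    by_contra hvV
    obtain ⟨p₁, q₁, hpq₁, hm₁⟩ := hF.frontier _ hy₁f
    obtain ⟨p₂, q₂, hpq₂, hm₂⟩ := hF.frontier _ hy₂f
    have hv₁ := hrF _ _ hpq₁ _ hm₁ hy₁b
    have hv₂ := hrF _ _ hpq₂ _ hm₂ hy₂b
    have := hF.noncrossing hpq₁ hpq₂ v hv₁ hv₂ hvV
    rw [← this] at hm₂
    exact hpos.ne' (orient_eq_zero_of_mem_segment hv₁ hm₁ hm₂)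
  have htri := hF.interior_triangle_subset hO hvV hr hrV hrF hy₁b hy₂b hpos hchord
  obtain ⟨hne₁, -, hne₂⟩ := ne_of_orient hpos.ne'
  obtain ⟨p₁, q₁, hpq₁, hm₁⟩ := hF.frontier _ hy₁f
  obtain ⟨p₂, q₂, hpq₂, hm₂⟩ := hF.frontier _ hy₂f
  obtain ⟨u, huV, hsu, hue, a, ha0, ha1, hya⟩ := hF.exists_arm hvV hrF hne₁.symm hy₁b hpq₁ hm₁
  obtain ⟨w, hwV, hsw, hwe, b, hb0, hb1, hyb⟩ := hF.exists_arm hvV hrF hne₂.symm hy₂b hpq₂ hm₂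
  have hscale : orient v y₁ y₂ = a * b * orient v u w := by
    rw [hya, hyb]
    simp only [orient, PiLp.add_apply, PiLp.smul_apply, PiLp.sub_apply, smul_eq_mul]; ring
  have huw : 0 < orient v u w := by
    rw [hscale] at hpos
    exact pos_of_mul_pos_right hpos (by positivity)
  obtain ⟨hvu, -, hvw⟩ := ne_of_orient huw.ne'
  have hnV : ∀ c, v ≠ c → (∀ z ∈ V, z ∈ segment ℝ v c → z = v ∨ z = c) →
      ∀ y ∈ openSegment ℝ v c, y ∉ V := by
    intro c hvc hce y hy hyV
    rcases hce y hyV (openSegment_subset_segment _ _ _ hy) with h | h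
    · subst h; exact hvc (left_mem_openSegment_iff.1 hy)
    · subst h; exact hvc (right_mem_openSegment_iff.1 hy)
  refine ⟨v, u, w, hvV, huV, hwV, huw, hue, hwe, ?_, ?_, ?_⟩
  · intro p q hpq y hy hyo z hz
    have := hF.noncrossing hpq hpq₁ y hy (by
      rw [hsu]; exact openSegment_subset_segment _ _ _ hyo) (hnV u hvu hue y hyo)
    rw [this, hsu] at hz
    exact orient_eq_zero_of_mem_segment (left_mem_segment _ _ _) (right_mem_segment _ _ _) hz
  · intro p q hpq y hy hyo z hz
    have := hF.noncrossing hpq hpq₂ y hy (by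
      rw [hsw]; exact openSegment_subset_segment _ _ _ hyo) (hnV w hvw hwe y hyo)
    rw [this, hsw] at hz
    exact orient_eq_zero_of_mem_segment (right_mem_segment _ _ _) (left_mem_segment _ _ _) hz
  · refine ⟨min a b, by positivity, fun α β hα hβ hαβ => htri ?_⟩
    have hadd := orient_add v y₁ y₂ (v + α • (u - v) + β • (w - v))
    have e : v + α • (u - v) + β • (w - v) = v + (α / a) • (y₁ - v) + (β / b) • (y₂ - v) := by
      have e1 : y₁ - v = a • (u - v) := by rw [hya]; module
      have e2 : y₂ - v = b • (w - v) := by rw [hyb]; module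
      rw [e1, e2, smul_smul, smul_smul, div_mul_cancel₀ _ ha0.ne', div_mul_cancel₀ _ hb0.ne']
    obtain ⟨l1, l2⟩ := orient_corner_coords v y₁ y₂ (α / a) (β / b)
    rw [← e] at l1 l2
    refine (mem_interior_triangle hpos).2 ⟨?_, ?_, ?_⟩
    · rw [l2]; positivity
    · have hab0 : 0 < min a b := lt_min ha0 hb0
      have h1 : α / a ≤ α / min a b := div_le_div_of_nonneg_left hα.le hab0 (min_le_left _ _)
      have h2 : β / b ≤ β / min a b := div_le_div_of_nonneg_left hβ.le hab0 (min_le_right _ _)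
      have h3 : α / min a b + β / min a b < 1 := by
        rw [← add_div]; exact (div_lt_one hab0).2 hαβ
      nlinarith
    · rw [l1]; positivity

/-- A nonempty bounded region bounded by segments contains an empty triangle. -/
theorem IsBarrier.exists_isEmptyTriangle {V : Finset Plane} {F : Plane → Plane → Prop}
    {O : Set Plane} (hF : IsBarrier V F O) (hO : IsOpen O) (hb : Bornology.IsBounded O)
    (hne : O.Nonempty) :
    ∃ t, IsEmptyTriangle V t ∧ interior (convexHull ℝ (t : Set Plane)) ⊆ O := by
  obtain ⟨v, u, w, hc⟩ := hF.exists_isClearCorner hO hb hne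
  exact hc.exists_isEmptyTriangle hF

/-! ### Packings of a polygon by empty triangles -/

section packing

variable {V : Finset Plane} {Q : Set Plane} {T : Finset (Finset Plane)} {t t' : Finset Plane}
  {p q : Plane}

lemma IsEmptyTriangle.side_disjoint (ht : IsEmptyTriangle V t) (hp : p ∈ t) (hq : q ∈ t)
    (hpq : p ≠ q) : Disjoint (segment ℝ p q) (interior (convexHull ℝ (t : Set Plane))) := by
  obtain ⟨a, b, c, rfl, h, hab⟩ := ht.exists_third_pos hp hq hpq
  have hs : segment ℝ p q = segment ℝ a b := by
    rcases hab with ⟨rfl, rfl⟩ | ⟨rfl, rfl⟩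
    · rfl
    · exact segment_symm _ _ _
  rw [hs, coe_triple]
  refine disjoint_left.2 fun x hx hxi => ?_
  exact ((mem_interior_triangle h).1 hxi).1.ne' (orient_eq_zero_of_mem_segment
    (left_mem_segment _ _ _) (right_mem_segment _ _ _) hx)

lemma IsEmptyTriangle.side_empty (ht : IsEmptyTriangle V t) (hp : p ∈ t) (hq : q ∈ t)
    (hpq : p ≠ q) : ∀ x ∈ V, x ∈ segment ℝ p q → x = p ∨ x = q := by
  intro x hx hxs
  have hxt := ht.empty x hx (segment_subset_convexHull hp hq hxs)
  obtain ⟨r, hr, h⟩ := ht.exists_third hp hq hpq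
  rw [hr] at hxt
  simp only [Finset.mem_insert, Finset.mem_singleton] at hxt
  rcases hxt with h' | h' | h'
  · exact Or.inl h'
  · exact Or.inr h'
  · subst h'
    exact absurd (orient_eq_zero_of_mem_segment (left_mem_segment _ _ _)
      (right_mem_segment _ _ _) hxs) h

lemma IsEmptyTriangle.subset_closure_interior (ht : IsEmptyTriangle V t) :
    convexHull ℝ (t : Set Plane) ⊆ closure (interior (convexHull ℝ (t : Set Plane))) := by
  obtain ⟨a, b, c, rfl, h⟩ := ht.exists_orient
  rw [coe_triple]
  exact triangle_subset_closure_interior h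

lemma IsEmptyTriangle.interior_nonempty (ht : IsEmptyTriangle V t) :
    (interior (convexHull ℝ (t : Set Plane))).Nonempty := by
  obtain ⟨a, b, c, hs, -⟩ := ht.exists_orient
  have ha : a ∈ (t : Set Plane) := by simp [hs]
  exact closure_nonempty_iff.1 ⟨a, ht.subset_closure_interior (subset_convexHull ℝ _ ha)⟩

lemma IsEmptyTriangle.affineIndependent (ht : IsEmptyTriangle V t) :
    AffineIndependent ℝ ((↑) : t → Plane) := by
  obtain ⟨a, b, c, hs, h⟩ := ht.exists_orient
  have := affineIndependent_coe_of_orient h.ne'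
  rw [← coe_triple, ← hs] at this
  exact this

lemma IsEmptyTriangle.eq_side (ht : IsEmptyTriangle V t) (hp : p ∈ t) (hq : q ∈ t) (hpq : p ≠ q)
    {v w y : Plane} (hv : v ∈ V) (hw : w ∈ V)
    (hvw : ∀ x ∈ V, x ∈ segment ℝ v w → x = v ∨ x = w)
    (hd : Disjoint (segment ℝ v w) (interior (convexHull ℝ (t : Set Plane))))
    (hyp : y ∈ segment ℝ p q) (hyv : y ∈ segment ℝ v w) (hy : y ∉ V) :
    (v = p ∧ w = q) ∨ (v = q ∧ w = p) := by
  obtain ⟨a, b, c, rfl, h, hab⟩ := ht.exists_third_pos hp hq hpq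
  rw [coe_triple] at hd
  have key := fun hya => segment_eq_side ht h hv hw hvw hd hya hyv hy
  rcases hab with ⟨rfl, rfl⟩ | ⟨rfl, rfl⟩
  · exact key hyp
  · exact (key (by rwa [segment_symm])).symm

/-- A finite family of empty triangles inside `Q` with pairwise disjoint interiors. -/
structure IsPacking (V : Finset Plane) (Q : Set Plane) (T : Finset (Finset Plane)) : Prop where
  isEmptyTriangle : ∀ t ∈ T, IsEmptyTriangle V t
  subset : ∀ t ∈ T, convexHull ℝ (t : Set Plane) ⊆ Q
  disjoint : ∀ t ∈ T, ∀ t' ∈ T, t ≠ t' →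
    Disjoint (interior (convexHull ℝ (t : Set Plane))) (interior (convexHull ℝ (t' : Set Plane)))

lemma IsPacking.triangle_disjoint_interior (hT : IsPacking V Q T) (ht : t ∈ T) (ht' : t' ∈ T)
    (hne : t ≠ t') :
    Disjoint (convexHull ℝ (t : Set Plane)) (interior (convexHull ℝ (t' : Set Plane))) :=
  ((hT.disjoint t ht t' ht' hne).closure_left isOpen_interior).mono_left
    (hT.isEmptyTriangle t ht).subset_closure_interior

lemma IsPacking.side_disjoint_interior (hT : IsPacking V Q T) (ht : t ∈ T) (ht' : t' ∈ T)
    (hp : p ∈ t) (hq : q ∈ t) (hpq : p ≠ q) :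
    Disjoint (segment ℝ p q) (interior (convexHull ℝ (t' : Set Plane))) := by
  by_cases h : t = t'
  · exact h ▸ (hT.isEmptyTriangle t ht).side_disjoint hp hq hpq
  · exact (hT.triangle_disjoint_interior ht ht' h).mono_left (segment_subset_convexHull hp hq)

lemma IsEmptyTriangle.exists_side_mem (ht : IsEmptyTriangle V t) {x : Plane}
    (hx : x ∈ convexHull ℝ (t : Set Plane)) (hi : x ∉ interior (convexHull ℝ (t : Set Plane))) :
    ∃ p ∈ t, ∃ q ∈ t, p ≠ q ∧ x ∈ segment ℝ p q := by
  obtain ⟨a, b, c, rfl, h, hs⟩ := ht.exists_side hx hi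
  exact ⟨a, by simp, b, by simp, (ne_of_orient h.ne').1, hs⟩

/-- The triangles of a packing automatically fit together face to face. -/
lemma IsPacking.inter_subset (hT : IsPacking V Q T) (ht : t ∈ T) (ht' : t' ∈ T) :
    convexHull ℝ (t : Set Plane) ∩ convexHull ℝ (t' : Set Plane) ⊆
      convexHull ℝ ((t : Set Plane) ∩ t') := by
  by_cases hne : t = t'
  · subst hne; simp
  have e := hT.isEmptyTriangle t ht
  have e' := hT.isEmptyTriangle t' ht'
  rintro x ⟨hx, hx'⟩
  by_cases hxV : x ∈ V
  · exact subset_convexHull _ _ ⟨e.empty x hxV hx, e'.empty x hxV hx'⟩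
  have h1 : x ∉ interior (convexHull ℝ (t : Set Plane)) := fun h =>
    disjoint_left.1 (hT.triangle_disjoint_interior ht' ht (Ne.symm hne)) hx' h
  have h2 : x ∉ interior (convexHull ℝ (t' : Set Plane)) := fun h =>
    disjoint_left.1 (hT.triangle_disjoint_interior ht ht' hne) hx h
  obtain ⟨p, hp, q, hq, hpq, hxs⟩ := e.exists_side_mem hx h1
  obtain ⟨p', hp', q', hq', hpq', hxs'⟩ := e'.exists_side_mem hx' h2
  have := e.eq_side hp hq hpq (e'.subset hp') (e'.subset hq') (e'.side_empty hp' hq' hpq')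
    (hT.side_disjoint_interior ht' ht hp' hq' hpq') hxs hxs' hxV
  have hpq' : p ∈ t' ∧ q ∈ t' := by
    rcases this with ⟨rfl, rfl⟩ | ⟨rfl, rfl⟩
    exacts [⟨hp', hq'⟩, ⟨hq', hp'⟩]
  exact segment_subset_convexHull (𝕜 := ℝ) (s := (t : Set Plane) ∩ t') ⟨hp, hpq'.1⟩
    ⟨hq, hpq'.2⟩ hxs

end packing

section polygon

variable {n : ℕ} {Q : Set Plane} {P : Polygon Plane n}

/-- The set `V` of vertices of a polygon. -/
noncomputable def Polygon.vertexFinset (P : Polygon Plane n) : Finset Plane :=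
  Finset.univ.image P.vertices

lemma Polygon.mem_vertexFinset {x : Plane} : x ∈ P.vertexFinset ↔ ∃ i, P i = x := by
  simp [Polygon.vertexFinset]

lemma Polygon.edgeSet_eq (i : Fin n) :
    P.edgeSet ℝ i = segment ℝ (P i) (P (finRotate n i)) := by
  rw [Polygon.edgeSet, affineSegment_eq_segment]

lemma IsPolygonWith.edge_empty (hP : IsPolygonWith Q P) (i : Fin n) :
    ∀ x ∈ P.vertexFinset, x ∈ segment ℝ (P i) (P (finRotate n i)) →
      x = P i ∨ x = P (finRotate n i) := by
  intro x hx hxs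
  obtain ⟨j, rfl⟩ := Polygon.mem_vertexFinset.1 hx
  by_contra! h
  have ho := mem_openSegment_of_ne_left_right h.1.symm h.2.symm hxs
  have hij : i ≠ j := by rintro rfl; exact h.1 rfl
  refine disjoint_left.1 (hP.disjoint_edges i j hij) ho ?_
  rw [Polygon.edgeSet_eq]
  exact left_mem_segment _ _ _

lemma IsPolygonWith.edge_disjoint (hP : IsPolygonWith Q P) (i : Fin n) :
    Disjoint (segment ℝ (P i) (P (finRotate n i))) (interior Q) := by
  refine disjoint_left.2 fun x hx hxi => ?_
  have : x ∈ frontier Q := by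
    rw [hP.frontier_eq, Polygon.boundary, mem_iUnion]
    exact ⟨i, by rwa [Polygon.edgeSet_eq]⟩
  exact this.2 hxi

lemma IsPolygonWith.edge_noncrossing (hP : IsPolygonWith Q P) {i j : Fin n} {x : Plane}
    (hi : x ∈ segment ℝ (P i) (P (finRotate n i))) (hj : x ∈ segment ℝ (P j) (P (finRotate n j)))
    (hx : x ∉ P.vertexFinset) : i = j := by
  by_contra hij
  have ho := mem_openSegment_of_ne_left_right
    (by rintro rfl; exact hx (Polygon.mem_vertexFinset.2 ⟨i, rfl⟩))
    (by rintro rfl; exact hx (Polygon.mem_vertexFinset.2 ⟨_, rfl⟩)) hi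
  exact disjoint_left.1 (hP.disjoint_edges i j hij) ho (by rwa [Polygon.edgeSet_eq])

/-- An edge of the polygon meets a side of an empty triangle in `Q` only at vertices, unless they
agree. -/
lemma IsPolygonWith.edge_eq_side (hP : IsPolygonWith Q P) {t : Finset Plane}
    (ht : IsEmptyTriangle P.vertexFinset t) (htQ : convexHull ℝ (t : Set Plane) ⊆ Q) {i : Fin n}
    {p q x : Plane} (hp : p ∈ t) (hq : q ∈ t) (hpq : p ≠ q)
    (hi : x ∈ segment ℝ (P i) (P (finRotate n i))) (hx : x ∈ segment ℝ p q)
    (hxV : x ∉ P.vertexFinset) :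
    (P i = p ∧ P (finRotate n i) = q) ∨ (P i = q ∧ P (finRotate n i) = p) :=
  ht.eq_side hp hq hpq (Polygon.mem_vertexFinset.2 ⟨_, rfl⟩) (Polygon.mem_vertexFinset.2 ⟨_, rfl⟩)
    (hP.edge_empty i) ((hP.edge_disjoint i).mono_right (interior_mono htQ)) hx hi hxV

/-- What a packing leaves uncovered of the interior of the polygon is bounded by edges of the
polygon and sides of triangles. -/
lemma IsPolygonWith.isBarrier (hP : IsPolygonWith Q P) {T : Finset (Finset Plane)}
    (hT : IsPacking P.vertexFinset Q T) :
    IsBarrier P.vertexFinset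
      (fun p q => (∃ i, p = P i ∧ q = P (finRotate n i)) ∨ ∃ t ∈ T, p ∈ t ∧ q ∈ t ∧ p ≠ q)
      (interior Q \ ⋃ t ∈ T, convexHull ℝ (t : Set Plane)) := by
  have hmemV : ∀ i, P i ∈ P.vertexFinset := fun i => Polygon.mem_vertexFinset.2 ⟨i, rfl⟩
  refine ⟨?_, ?_, ?_, ?_, ?_, ?_⟩
  · rintro p q (⟨i, rfl, rfl⟩ | ⟨t, ht, hp, hq, hpq⟩)
    · exact hmemV _
    · exact (hT.isEmptyTriangle t ht).subset hp
  · rintro p q (⟨i, rfl, rfl⟩ | ⟨t, ht, hp, hq, hpq⟩)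
    · exact hmemV _
    · exact (hT.isEmptyTriangle t ht).subset hq
  · rintro p q (⟨i, rfl, rfl⟩ | ⟨t, ht, hp, hq, hpq⟩)
    · exact hP.edge_empty i
    · exact (hT.isEmptyTriangle t ht).side_empty hp hq hpq
  · rintro p q (⟨i, rfl, rfl⟩ | ⟨t, ht, hp, hq, hpq⟩)
    · exact (hP.edge_disjoint i).mono_right sdiff_subset
    · refine disjoint_left.2 fun x hx hxO => hxO.2 ?_
      exact mem_biUnion (x := t) ht (segment_subset_convexHull hp hq hx)
  · intro x hx
    have hopen : IsOpen (interior Q \ ⋃ t ∈ T, convexHull ℝ (t : Set Plane)) :=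
      isOpen_interior.sdiff ((Finset.finite_toSet T).isClosed_biUnion fun t _ =>
        ((Finset.finite_toSet t).isCompact_convexHull ℝ).isClosed)
    rw [hopen.frontier_eq] at hx
    obtain ⟨hxc, hxO⟩ := hx
    by_cases hxi : x ∈ interior Q
    · have hxU : x ∈ ⋃ t ∈ T, convexHull ℝ (t : Set Plane) := by
        by_contra h; exact hxO ⟨hxi, h⟩
      simp only [mem_iUnion] at hxU
      obtain ⟨t, ht, hxt⟩ := hxU
      have hni : x ∉ interior (convexHull ℝ (t : Set Plane)) := by
        intro h
        obtain ⟨y, hy, hyO⟩ := mem_closure_iff.1 hxc _ isOpen_interior h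
        exact hyO.2 (mem_biUnion (x := t) ht (interior_subset hy))
      obtain ⟨p, hp, q, hq, hpq, hxs⟩ := (hT.isEmptyTriangle t ht).exists_side_mem hxt hni
      exact ⟨p, q, Or.inr ⟨t, ht, hp, hq, hpq⟩, hxs⟩
    · have hxQ : x ∈ Q := by
        rw [← hP.isClosed.closure_eq]
        exact closure_mono (sdiff_subset.trans interior_subset) hxc
      have : x ∈ frontier Q := ⟨subset_closure hxQ, hxi⟩
      rw [hP.frontier_eq, Polygon.boundary, mem_iUnion] at this
      obtain ⟨i, hi⟩ := this
      rw [Polygon.edgeSet_eq] at hi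
      exact ⟨_, _, Or.inl ⟨i, rfl, rfl⟩, hi⟩
  · have swap : ∀ p q p' q' : Plane, (p = p' ∧ q = q') ∨ (p = q' ∧ q = p') →
        segment ℝ p q = segment ℝ p' q' := by
      rintro p q p' q' (⟨rfl, rfl⟩ | ⟨rfl, rfl⟩)
      · rfl
      · exact segment_symm _ _ _
    rintro p q p' q' (⟨i, rfl, rfl⟩ | ⟨t, ht, hp, hq, hpq⟩)
      (⟨j, rfl, rfl⟩ | ⟨t', ht', hp', hq', hpq'⟩) x hx hx' hxV
    · rw [hP.edge_noncrossing hx hx' hxV]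
    · exact swap _ _ _ _ (hP.edge_eq_side (hT.isEmptyTriangle t' ht') (hT.subset t' ht')
        hp' hq' hpq' hx hx' hxV)
    · exact (swap _ _ _ _ (hP.edge_eq_side (hT.isEmptyTriangle t ht) (hT.subset t ht)
        hp hq hpq hx' hx hxV)).symm
    · have e := hT.isEmptyTriangle t ht
      have e' := hT.isEmptyTriangle t' ht'
      exact (swap _ _ _ _ (e.eq_side hp hq hpq (e'.subset hp') (e'.subset hq')
        (e'.side_empty hp' hq' hpq') (hT.side_disjoint_interior ht' ht hp' hq' hpq')
        hx hx' hxV)).symm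

lemma IsPacking.mem_powerset {V : Finset Plane} {T : Finset (Finset Plane)}
    (hT : IsPacking V Q T) : T ∈ V.powerset.powerset :=
  Finset.mem_powerset.2 fun t ht => Finset.mem_powerset.2 (hT.isEmptyTriangle t ht).subset

/-- A packing of the polygon with the largest number of triangles covers it: in an uncovered region
there would be room for one more triangle. -/
theorem IsPolygonWith.exists_triangulation (hP : IsPolygonWith Q P) :
    ∃ T, IsPacking P.vertexFinset Q T ∧ Q ⊆ ⋃ t ∈ T, convexHull ℝ (t : Set Plane) := by
  set 𝒮 := P.vertexFinset.powerset.powerset.filter (fun T => IsPacking P.vertexFinset Q T)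
  have hne : 𝒮.Nonempty := ⟨∅, Finset.mem_filter.2 ⟨by simp, by constructor <;> simp⟩⟩
  obtain ⟨T, hTS, hmax⟩ := 𝒮.exists_max_image Finset.card hne
  have hT := (Finset.mem_filter.1 hTS).2
  refine ⟨T, hT, ?_⟩
  have hclosed : IsClosed (⋃ t ∈ T, convexHull ℝ (t : Set Plane)) :=
    (Finset.finite_toSet T).isClosed_biUnion fun t _ =>
      ((Finset.finite_toSet t).isCompact_convexHull ℝ).isClosed
  by_contra hsub
  have hO : (interior Q \ ⋃ t ∈ T, convexHull ℝ (t : Set Plane)).Nonempty := by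
    rw [sdiff_nonempty]
    intro h
    apply hsub
    rw [← hP.closure_interior]
    exact hclosed.closure_subset_iff.2 h
  obtain ⟨t, ht, htO⟩ := (hP.isBarrier hT).exists_isEmptyTriangle
    (isOpen_interior.sdiff hclosed)
    (hP.isBounded.subset (sdiff_subset.trans interior_subset)) hO
  have htQ : convexHull ℝ (t : Set Plane) ⊆ Q := by
    refine ht.subset_closure_interior.trans ?_
    rw [← hP.isClosed.closure_eq]
    exact closure_mono (htO.trans (sdiff_subset.trans interior_subset))
  have hdis : ∀ t' ∈ T, Disjoint (interior (convexHull ℝ (t : Set Plane)))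
      (interior (convexHull ℝ (t' : Set Plane))) := fun t' ht' =>
    disjoint_left.2 fun x hx hx' => (htO hx).2 (mem_biUnion (x := t') ht' (interior_subset hx'))
  have htT : t ∉ T := by
    intro h
    have := hdis t h
    rw [disjoint_self] at this
    exact ht.interior_nonempty.ne_empty this
  have hT' : IsPacking P.vertexFinset Q (insert t T) := by
    refine ⟨?_, ?_, ?_⟩
    · intro s hs
      rcases Finset.mem_insert.1 hs with rfl | hs
      exacts [ht, hT.isEmptyTriangle s hs]
    · intro s hs
      rcases Finset.mem_insert.1 hs with rfl | hs
      exacts [htQ, hT.subset s hs]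
    · intro s hs s' hs' hne
      rcases Finset.mem_insert.1 hs with h | h <;> rcases Finset.mem_insert.1 hs' with h' | h'
      · exact absurd (h.trans h'.symm) hne
      · exact h ▸ hdis s' h'
      · exact h' ▸ (hdis s h).symm
      · exact hT.disjoint s h s' h' hne
  have := hmax _ (Finset.mem_filter.2 ⟨hT'.mem_powerset, hT'⟩)
  rw [Finset.card_insert_of_notMem htT] at this
  omega

end polygon

/-! ### Flipping a diagonal -/

/-- The area of the triangle with vertex set `t`, doubled, written as a symmetric sum over all
ordered triples of corners. -/
noncomputable def doubleArea (t : Finset Plane) : ℝ :=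
  (∑ a ∈ t, ∑ b ∈ t, ∑ c ∈ t, |orient a b c|) / 6

lemma doubleArea_triple {a b c : Plane} (h : orient a b c ≠ 0) :
    doubleArea {a, b, c} = |orient a b c| := by
  obtain ⟨hab, hbc, hac⟩ := ne_of_orient h
  have h1 : orient b c a = orient a b c := orient_rotate a b c
  have h2 : orient c a b = orient a b c := by rw [orient_rotate b c a, h1]
  have h3 : orient a c b = -orient a b c := by rw [orient_swap, h2]
  have h4 : orient b a c = -orient a b c := orient_swap _ _ _
  have h5 : orient c b a = -orient a b c := by rw [orient_swap, h1]
  have hsum : ∀ f : Plane → ℝ, ∑ x ∈ ({a, b, c} : Finset Plane), f x = f a + f b + f c := by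
    intro f
    rw [Finset.sum_insert (by simp [hab, hac]), Finset.sum_insert (by simp [hbc]),
      Finset.sum_singleton]
    ring
  simp only [doubleArea, hsum,
    orient_self_left, orient_self_mid, orient_self_outer, h1, h2, h3, h4, h5, abs_neg, abs_zero]
  ring

lemma doubleArea_nonneg (t : Finset Plane) : 0 ≤ doubleArea t := by
  unfold doubleArea; positivity

/-- The integral of the interpolated paraboloid `‖x‖ ^ 2` over a triangle, up to a constant factor.
Its sum over a triangulation is decreased by flips towards a Delaunay triangulation. -/
noncomputable def delaunayCost (t : Finset Plane) : ℝ :=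
  doubleArea t * ∑ v ∈ t, ‖v‖ ^ 2

lemma delaunayCost_nonneg (t : Finset Plane) : 0 ≤ delaunayCost t :=
  mul_nonneg (doubleArea_nonneg t) (by positivity)

lemma delaunayCost_triple {a b c : Plane} (h : 0 < orient a b c) :
    delaunayCost {a, b, c} = orient a b c * (‖a‖ ^ 2 + ‖b‖ ^ 2 + ‖c‖ ^ 2) := by
  obtain ⟨hab, hbc, hac⟩ := ne_of_orient h.ne'
  rw [delaunayCost, doubleArea_triple h.ne', abs_of_pos h,
    Finset.sum_insert (by simp [hab, hac]), Finset.sum_insert (by simp [hbc]),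
    Finset.sum_singleton]
  ring

lemma norm_sq_plane (x : Plane) : ‖x‖ ^ 2 = x 0 ^ 2 + x 1 ^ 2 := by
  rw [EuclideanSpace.norm_sq_eq, Fin.sum_univ_two]; simp

/-- A packing that covers `Q`. -/
structure IsTriangulation (V : Finset Plane) (Q : Set Plane) (T : Finset (Finset Plane)) : Prop
    extends IsPacking V Q T where
  cover : Q ⊆ ⋃ t ∈ T, convexHull ℝ (t : Set Plane)

/-- A diagonal `p r` cuts the convex quadrilateral `p q r s` into two triangles. -/
lemma triangle_union_triangle {p q r s : Plane} (h1 : 0 < orient p q r) (h2 : 0 < orient r s p)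
    (h3 : 0 < orient q r s) (h4 : 0 < orient s p q) :
    convexHull ℝ ({p, q, r} : Set Plane) ∪ convexHull ℝ ({r, s, p} : Set Plane) =
      {x | 0 ≤ orient p q x ∧ 0 ≤ orient q r x ∧ 0 ≤ orient r s x ∧ 0 ≤ orient s p x} := by
  have e1 : orient r s q = orient q r s := orient_rotate q r s
  have e2 : orient s p r = orient r s p := orient_rotate r s p
  have e3 : orient p q s = orient s p q := orient_rotate s p q
  have e4 : orient q r p = orient p q r := orient_rotate p q r
  ext x
  simp only [mem_union, mem_triangle h1, mem_triangle h2, mem_ofPred_eq]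
  have hmem : ∀ {a b c u v : Plane}, 0 < orient a b c → 0 ≤ orient u v a → 0 ≤ orient u v b →
      0 ≤ orient u v c → 0 ≤ orient a b x → 0 ≤ orient b c x → 0 ≤ orient c a x →
      0 ≤ orient u v x := by
    intro a b c u v h ha hb hc k1 k2 k3
    refine convexHull_min ?_ (convex_orient_nonneg u v) ((mem_triangle h).2 ⟨k1, k2, k3⟩)
    rintro y (rfl | rfl | rfl) <;> assumption
  constructor
  · rintro (⟨k1, k2, k3⟩ | ⟨k1, k2, k3⟩)
    · exact ⟨k1, k2, hmem h1 h2.le (by rw [e1]; exact h3.le) (by simp) k1 k2 k3,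
        hmem h1 (by simp) h4.le (by rw [e2]; exact h2.le) k1 k2 k3⟩
    · exact ⟨hmem h2 h1.le (by rw [e3]; exact h4.le) (by simp) k1 k2 k3,
        hmem h2 (by simp) h3.le (by rw [e4]; exact h1.le) k1 k2 k3, k1, k2⟩
  · rintro ⟨k1, k2, k3, k4⟩
    rcases le_total 0 (orient r p x) with h | h
    · exact Or.inl ⟨k1, k2, h⟩
    · exact Or.inr ⟨k3, k4, by rw [orient_swap]; linarith⟩

section flip

variable {V : Finset Plane} {Q : Set Plane} {T : Finset (Finset Plane)} {a b c d : Plane}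

/-- Replacing the diagonal `a b` of a strictly convex quadrilateral `a d b c` by the diagonal `d c`
turns a triangulation into another one. -/
lemma IsTriangulation.flip (hT : IsTriangulation V Q T) (ht₁ : ({b, c, a} : Finset Plane) ∈ T)
    (ht₂ : ({a, d, b} : Finset Plane) ∈ T) (h1 : 0 < orient a d b) (h2 : 0 < orient b c a)
    (h3 : 0 < orient d b c) (h4 : 0 < orient c a d) :
    IsTriangulation V Q (insert {d, b, c} (insert {c, a, d}
      ((T.erase {b, c, a}).erase {a, d, b}))) := by
  have hM := triangle_union_triangle h1 h2 h3 h4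
  have hM' := triangle_union_triangle h3 h4 h2 h1
  have hMM : convexHull ℝ ({d, b, c} : Set Plane) ∪ convexHull ℝ ({c, a, d} : Set Plane) =
      convexHull ℝ ({a, d, b} : Set Plane) ∪ convexHull ℝ ({b, c, a} : Set Plane) := by
    rw [hM, hM']; ext x; simp only [mem_ofPred_eq]; tauto
  have E₁ := hT.isEmptyTriangle _ ht₁
  have E₂ := hT.isEmptyTriangle _ ht₂
  have haV : a ∈ V := E₂.subset (by simp)
  have hbV : b ∈ V := E₂.subset (by simp)
  have hcV : c ∈ V := E₁.subset (by simp)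
  have hdV : d ∈ V := E₂.subset (by simp)
  have hsub₃ : convexHull ℝ ({d, b, c} : Set Plane) ⊆
      convexHull ℝ ({a, d, b} : Set Plane) ∪ convexHull ℝ ({b, c, a} : Set Plane) :=
    subset_union_left.trans hMM.subset
  have hsub₄ : convexHull ℝ ({c, a, d} : Set Plane) ⊆
      convexHull ℝ ({a, d, b} : Set Plane) ∪ convexHull ℝ ({b, c, a} : Set Plane) :=
    subset_union_right.trans hMM.subset
  have hVM : ∀ x ∈ V, x ∈ convexHull ℝ ({a, d, b} : Set Plane) ∪
      convexHull ℝ ({b, c, a} : Set Plane) → x = a ∨ x = b ∨ x = c ∨ x = d := by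
    rintro x hx (h | h)
    · have := E₂.empty x hx (by rwa [coe_triple])
      simp only [Finset.mem_insert, Finset.mem_singleton] at this; tauto
    · have := E₁.empty x hx (by rwa [coe_triple])
      simp only [Finset.mem_insert, Finset.mem_singleton] at this; tauto
  have E₃ : IsEmptyTriangle V {d, b, c} := by
    refine ⟨?_, ⟨_, _, _, rfl, h3⟩, fun x hx hxt => ?_⟩
    · intro x hx
      simp only [Finset.mem_insert, Finset.mem_singleton] at hx
      rcases hx with rfl | rfl | rfl <;> assumption
    · rw [coe_triple] at hxt
      rcases hVM x hx (hsub₃ hxt) with rfl | rfl | rfl | rfl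
      · have := ((mem_triangle h3).1 hxt).2.2
        rw [orient_swap, ← orient_rotate d c x] at this
        linarith
      all_goals simp
  have E₄ : IsEmptyTriangle V {c, a, d} := by
    refine ⟨?_, ⟨_, _, _, rfl, h4⟩, fun x hx hxt => ?_⟩
    · intro x hx
      simp only [Finset.mem_insert, Finset.mem_singleton] at hx
      rcases hx with rfl | rfl | rfl <;> assumption
    · rw [coe_triple] at hxt
      rcases hVM x hx (hsub₄ hxt) with rfl | rfl | rfl | rfl
      · simp
      · have := ((mem_triangle h4).1 hxt).2.2
        have e : orient d c x = -orient d x c := orient_swap_right _ _ _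
        linarith
      all_goals simp
  have hQ : convexHull ℝ ({a, d, b} : Set Plane) ∪ convexHull ℝ ({b, c, a} : Set Plane) ⊆ Q := by
    refine union_subset ?_ ?_
    · rw [← coe_triple]; exact hT.subset _ ht₂
    · rw [← coe_triple]; exact hT.subset _ ht₁
  set T₀ := (T.erase {b, c, a}).erase {a, d, b} with hT₀
  have hT₀T : ∀ t ∈ T₀, t ∈ T ∧ t ≠ {b, c, a} ∧ t ≠ {a, d, b} := by
    intro t ht
    simp only [hT₀, Finset.mem_erase] at ht
    exact ⟨ht.2.2, ht.2.1, ht.1⟩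
  have hdisM : ∀ t ∈ T₀, Disjoint (convexHull ℝ ({a, d, b} : Set Plane) ∪
      convexHull ℝ ({b, c, a} : Set Plane)) (interior (convexHull ℝ (t : Set Plane))) := by
    intro t ht
    obtain ⟨htT, hne₁, hne₂⟩ := hT₀T t ht
    refine disjoint_union_left.2 ⟨?_, ?_⟩
    · rw [← coe_triple]; exact hT.triangle_disjoint_interior ht₂ htT hne₂.symm
    · rw [← coe_triple]; exact hT.triangle_disjoint_interior ht₁ htT hne₁.symm
  have hdis₃ : ∀ t ∈ T₀, Disjoint (interior (convexHull ℝ (({d, b, c} : Finset Plane) : Set Plane)))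
      (interior (convexHull ℝ (t : Set Plane))) := fun t ht => by
    rw [coe_triple]; exact (hdisM t ht).mono_left (interior_subset.trans hsub₃)
  have hdis₄ : ∀ t ∈ T₀, Disjoint (interior (convexHull ℝ (({c, a, d} : Finset Plane) : Set Plane)))
      (interior (convexHull ℝ (t : Set Plane))) := fun t ht => by
    rw [coe_triple]; exact (hdisM t ht).mono_left (interior_subset.trans hsub₄)
  have hdis₃₄ : Disjoint (interior (convexHull ℝ (({d, b, c} : Finset Plane) : Set Plane)))
      (interior (convexHull ℝ (({c, a, d} : Finset Plane) : Set Plane))) := by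
    rw [coe_triple, coe_triple]
    refine disjoint_left.2 fun x hx hx' => ?_
    have k := ((mem_interior_triangle h3).1 hx).2.2
    have k' := ((mem_interior_triangle h4).1 hx').2.2
    rw [orient_swap] at k'
    linarith
  refine ⟨⟨?_, ?_, ?_⟩, ?_⟩
  · intro t ht
    simp only [Finset.mem_insert] at ht
    rcases ht with rfl | rfl | ht
    exacts [E₃, E₄, hT.isEmptyTriangle t (hT₀T t ht).1]
  · intro t ht
    simp only [Finset.mem_insert] at ht
    rcases ht with rfl | rfl | ht
    · rw [coe_triple]; exact hsub₃.trans hQ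
    · rw [coe_triple]; exact hsub₄.trans hQ
    · exact hT.subset t (hT₀T t ht).1
  · intro t ht t' ht' hne
    simp only [Finset.mem_insert] at ht ht'
    rcases ht with h | h | h <;> rcases ht' with h' | h' | h'
    · exact absurd (h.trans h'.symm) hne
    · rw [h, h']; exact hdis₃₄
    · rw [h]; exact hdis₃ t' h'
    · rw [h, h']; exact hdis₃₄.symm
    · exact absurd (h.trans h'.symm) hne
    · rw [h]; exact hdis₄ t' h'
    · rw [h']; exact (hdis₃ t h).symm
    · rw [h']; exact (hdis₄ t h).symm
    · exact hT.disjoint t (hT₀T t h).1 t' (hT₀T t' h').1 hne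
  · intro x hx
    have := hT.cover hx
    simp only [mem_iUnion] at this ⊢
    obtain ⟨t, ht, hxt⟩ := this
    by_cases hM₁₂ : x ∈ convexHull ℝ ({a, d, b} : Set Plane) ∪ convexHull ℝ ({b, c, a} : Set Plane)
    · rw [← hMM] at hM₁₂
      rcases hM₁₂ with h | h
      · exact ⟨_, Finset.mem_insert_self _ _, by rwa [coe_triple]⟩
      · exact ⟨_, Finset.mem_insert_of_mem (Finset.mem_insert_self _ _), by rwa [coe_triple]⟩
    · refine ⟨t, Finset.mem_insert_of_mem (Finset.mem_insert_of_mem ?_), hxt⟩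
      refine Finset.mem_erase.2 ⟨?_, Finset.mem_erase.2 ⟨?_, ht⟩⟩
      · rintro rfl; rw [coe_triple] at hxt; exact hM₁₂ (Or.inl hxt)
      · rintro rfl; rw [coe_triple] at hxt; exact hM₁₂ (Or.inr hxt)

/-- The local Delaunay condition: in a triangulation of least cost, the two angles opposite to the
diagonal of a strictly convex quadrilateral have sum at most `π`. -/
lemma IsTriangulation.flip_inequality (hT : IsTriangulation V Q T)
    (hmin : ∀ T', IsTriangulation V Q T' → ∑ t ∈ T, delaunayCost t ≤ ∑ t ∈ T', delaunayCost t)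
    (ht₁ : ({b, c, a} : Finset Plane) ∈ T) (ht₂ : ({a, d, b} : Finset Plane) ∈ T)
    (h1 : 0 < orient a d b) (h2 : 0 < orient b c a) (h3 : 0 < orient d b c)
    (h4 : 0 < orient c a d) :
    0 ≤ orient a d b * inner ℝ (c - a) (c - b) + orient b c a * inner ℝ (d - a) (d - b) := by
  have hle := hmin _ (hT.flip ht₁ ht₂ h1 h2 h3 h4)
  have hne : ({a, d, b} : Finset Plane) ≠ {b, c, a} := by
    intro h
    have hd : d ∈ ({b, c, a} : Finset Plane) := by rw [← h]; simp
    simp only [Finset.mem_insert, Finset.mem_singleton] at hd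
    rcases hd with rfl | rfl | rfl
    · simp at h1
    · simp at h3
    · simp at h1
  have hins : ∀ (S : Finset (Finset Plane)) (t : Finset Plane),
      ∑ s ∈ insert t S, delaunayCost s ≤ delaunayCost t + ∑ s ∈ S, delaunayCost s := by
    intro S t
    by_cases h : t ∈ S
    · rw [Finset.insert_eq_of_mem h]; linarith [delaunayCost_nonneg t]
    · rw [Finset.sum_insert h]
  have s1 := Finset.add_sum_erase T delaunayCost ht₁
  have s2 := Finset.add_sum_erase (T.erase {b, c, a}) delaunayCost
    (Finset.mem_erase.2 ⟨hne, ht₂⟩)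
  have s3 := hins (insert {c, a, d} ((T.erase {b, c, a}).erase {a, d, b})) {d, b, c}
  have s4 := hins ((T.erase {b, c, a}).erase {a, d, b}) {c, a, d}
  rw [delaunayCost_triple h2] at s1
  rw [delaunayCost_triple h1] at s2
  rw [delaunayCost_triple h3] at s3
  rw [delaunayCost_triple h4] at s4
  have key : orient b c a * (‖b‖ ^ 2 + ‖c‖ ^ 2 + ‖a‖ ^ 2) +
      orient a d b * (‖a‖ ^ 2 + ‖d‖ ^ 2 + ‖b‖ ^ 2) ≤
      orient d b c * (‖d‖ ^ 2 + ‖b‖ ^ 2 + ‖c‖ ^ 2) +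
      orient c a d * (‖c‖ ^ 2 + ‖a‖ ^ 2 + ‖d‖ ^ 2) := by linarith
  rw [← sub_nonneg] at key
  refine key.trans_eq ?_
  simp only [norm_sq_plane, inner_plane, orient, PiLp.sub_apply]
  ring

end flip

section adjacent

variable {n : ℕ} {Q : Set Plane} {P : Polygon Plane n} {T : Finset (Finset Plane)} {a b c : Plane}

/-- Across a side that is not an edge of the polygon there is another triangle. -/
lemma IsTriangulation.exists_adjacent (hP : IsPolygonWith Q P)
    (hT : IsTriangulation P.vertexFinset Q T) (ht : ({a, b, c} : Finset Plane) ∈ T)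
    (h : 0 < orient a b c) (hne : ¬ IsPolygonEdge P a b) :
    ∃ d, ({a, b, d} : Finset Plane) ∈ T ∧ orient a b d < 0 := by
  have e := hT.isEmptyTriangle _ ht
  obtain ⟨hab, hbc, hac⟩ := ne_of_orient h.ne'
  set y := a + (1 / 2 : ℝ) • (b - a) with hy
  have hyo : y ∈ openSegment ℝ a b := by
    rw [openSegment_eq_image']; exact ⟨1 / 2, by norm_num, rfl⟩
  have hys := openSegment_subset_segment _ _ _ hyo
  have hyV : y ∉ P.vertexFinset := by
    intro hV
    rcases e.side_empty (p := a) (q := b) (by simp) (by simp) hab y hV hys with h' | h'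
    · rw [h'] at hyo; exact hab (left_mem_openSegment_iff.1 hyo)
    · rw [h'] at hyo; exact hab (right_mem_openSegment_iff.1 hyo)
  have hyt : y ∈ convexHull ℝ (({a, b, c} : Finset Plane) : Set Plane) :=
    segment_subset_convexHull (by simp) (by simp) hys
  have hyQ : y ∈ interior Q := by
    by_contra hyi
    have : y ∈ frontier Q := ⟨subset_closure (hT.subset _ ht hyt), hyi⟩
    rw [hP.frontier_eq, Polygon.boundary, mem_iUnion] at this
    obtain ⟨i, hi⟩ := this
    rw [Polygon.edgeSet_eq] at hi
    apply hne
    refine ⟨i, ?_⟩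
    rw [Sym2.eq_iff]
    rcases hP.edge_eq_side e (hT.subset _ ht) (by simp) (by simp) hab hi hys hyV with
      ⟨h1, h2⟩ | ⟨h1, h2⟩
    · exact Or.inl ⟨h1.symm, h2.symm⟩
    · exact Or.inr ⟨h2.symm, h1.symm⟩
  have hay : orient a b y = 0 := by rw [hy, orient_line]; simp
  -- points just across the side lie in the other triangles, whose union is closed
  have hyC : y ∈ ⋃ t ∈ T.erase {a, b, c}, convexHull ℝ (t : Set Plane) := by
    have hclosed : IsClosed (⋃ t ∈ T.erase {a, b, c}, convexHull ℝ (t : Set Plane)) :=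
      (Finset.finite_toSet (T.erase {a, b, c})).isClosed_biUnion fun t _ =>
        ((Finset.finite_toSet t).isCompact_convexHull ℝ).isClosed
    have hcont : Continuous fun s : ℝ => y + s • (y - c) := by fun_prop
    have hlim : Filter.Tendsto (fun s : ℝ => y + s • (y - c)) (𝓝[>] 0) (𝓝 y) := by
      have := (hcont.tendsto 0).mono_left (nhdsWithin_le_nhds (s := Ioi 0))
      simpa using this
    refine hclosed.mem_of_tendsto hlim ?_
    filter_upwards [hlim.eventually (isOpen_interior.mem_nhds hyQ), self_mem_nhdsWithin]
      with s hs hs0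
    have hs0' : 0 < s := hs0
    have := hT.cover (interior_subset hs)
    simp only [mem_iUnion] at this ⊢
    obtain ⟨t, htT, hst⟩ := this
    refine ⟨t, Finset.mem_erase.2 ⟨?_, htT⟩, hst⟩
    rintro rfl
    rw [coe_triple] at hst
    have h1 := ((mem_triangle h).1 hst).1
    have h2 : orient a b (y + s • (y - c)) = (1 + s) * orient a b y - s * orient a b c := by
      simp only [orient, PiLp.add_apply, PiLp.smul_apply, PiLp.sub_apply, smul_eq_mul]; ring
    rw [h2, hay] at h1
    nlinarith [mul_pos hs0' h]
  simp only [mem_iUnion] at hyC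
  obtain ⟨t', ht', hyt'⟩ := hyC
  obtain ⟨htne, ht'⟩ := Finset.mem_erase.1 ht'
  have hyI := hT.inter_subset ht ht' ⟨hyt, hyt'⟩
  have hbca : orient b c a = orient a b c := orient_rotate a b c
  have hcab : orient c a b = orient a b c := by rw [orient_rotate b c a, hbca]
  have hat' : a ∈ t' := by
    by_contra hat'
    have : y ∈ segment ℝ b c := by
      rw [← convexHull_pair]
      refine convexHull_mono ?_ hyI
      rintro z ⟨hz, hz'⟩
      simp only [Finset.coe_insert, Finset.coe_singleton, mem_insert_iff, mem_singleton_iff] at hz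
      rcases hz with rfl | hz | hz
      · exact absurd hz' hat'
      · exact Or.inl hz
      · exact Or.inr hz
    have h0 := orient_eq_zero_of_mem_segment (left_mem_segment ℝ b c) (right_mem_segment _ _ _) this
    rw [hy, orient_line, hbca, orient_self_outer] at h0
    linarith
  have hbt' : b ∈ t' := by
    by_contra hbt'
    have : y ∈ segment ℝ c a := by
      rw [← convexHull_pair]
      refine convexHull_mono ?_ hyI
      rintro z ⟨hz, hz'⟩
      simp only [Finset.coe_insert, Finset.coe_singleton, mem_insert_iff, mem_singleton_iff] at hz
      rcases hz with hz | rfl | hz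
      · exact Or.inr hz
      · exact absurd hz' hbt'
      · exact Or.inl hz
    have h0 := orient_eq_zero_of_mem_segment (left_mem_segment ℝ c a) (right_mem_segment _ _ _) this
    rw [hy, orient_line, hcab, orient_self_mid] at h0
    linarith
  obtain ⟨d, rfl, hd⟩ := (hT.isEmptyTriangle _ ht').exists_third hat' hbt' hab
  refine ⟨d, ht', ?_⟩
  by_contra! hd'
  have hdpos : 0 < orient a b d := lt_of_le_of_ne hd' hd.symm
  obtain ⟨s, hs1, hs2⟩ := ((eventually_mem_interior_triangle h hyo h).and
    (eventually_mem_interior_triangle hdpos hyo h)).exists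
  exact disjoint_left.1 (hT.disjoint _ ht _ ht' htne.symm) (by rwa [coe_triple])
    (by rwa [coe_triple])

end adjacent

/-! ### Flat triangles -/

/-- The metric part of the argument, for a triangle `a b c` with longest side `ab` and a triangle
`a b d` on the other side of `ab`, where `M` bounds all squared distances. The variables are
`L = |ab|²`, `u = |ac|²`, `v = |bc|²`, `u' = |ad|²`, `v' = |bd|²`, the inner products
`p = ⟨c - a, b - a⟩`, `q = ⟨d - a, b - a⟩`, and the doubled areas `H`, `K`, `X`, `Y` of `abc`,
`abd`, `adc`, `dbc`, the latter two signed. -/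
lemma flat_of_flat {M L u v p H u' v' q K X Y : ℝ} (hM : 1 ≤ M)
    (hu : p ^ 2 + H ^ 2 = u * L) (hv : v = u - 2 * p + L)
    (hu' : q ^ 2 + K ^ 2 = u' * L) (hv' : v' = u' - 2 * q + L)
    (hX : X * L = q * H + K * p) (hY : Y * L = (L - q) * H + K * (L - p))
    (u1 : 1 ≤ u) (v1 : 1 ≤ v) (L1 : 1 ≤ L) (u1' : 1 ≤ u') (v1' : 1 ≤ v')
    (LM : L ≤ M) (uM' : u' ≤ M) (vM' : v' ≤ M) (uL : u ≤ L) (vL : v ≤ L)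
    (H0 : 0 < H) (K0 : 0 < K) (hH : H * (24 * M ^ 2) ≤ 1)
    (hflip : 0 < X → 0 < Y → 0 ≤ K * (u - p) + H * (u' - q)) :
    K ≤ 8 * M ^ 2 * H ∧ (L < u' ∨ L < v') := by
  have hL0 : 0 < L := by linarith
  have hM0 : 0 < M := by linarith
  have hp : 1 / 2 ≤ p := by linarith
  have hp' : 1 / 2 ≤ L - p := by linarith
  have hM2 : 1 ≤ M ^ 2 := one_le_pow₀ hM
  have hMM : M ≤ M ^ 2 := le_self_pow₀ hM two_ne_zero
  have hMH : 0 < M ^ 2 * H := by positivity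
  have hMH' : M * H ≤ M ^ 2 * H := mul_le_mul_of_nonneg_right hMM H0.le
  have sq_le : ∀ x : ℝ, 0 < x → x ≤ 1 / 3 → x ^ 2 ≤ 1 / 8 := fun x h0 h1 =>
    (pow_le_pow_left₀ h0.le h1 2).trans (by norm_num)
  have hH8 : H ^ 2 ≤ 1 / 8 := by
    have : H * 24 ≤ H * (24 * M ^ 2) := mul_le_mul_of_nonneg_left (by linarith) H0.le
    exact sq_le H H0 (by linarith)
  -- if `x, L - x ≥ 1/2`, then `x * (L - x)` is at least `1/4`
  have quarter : ∀ x : ℝ, 1 / 2 ≤ x → 1 / 2 ≤ L - x → 1 / 4 ≤ x * (L - x) := fun x h h' =>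
    le_trans (by norm_num) (mul_le_mul h h' (by norm_num) (by linarith))
  have neg_of : ∀ x : ℝ, L * x ≤ -1 / 8 → x < 0 := fun x hx => by
    by_contra! h
    linarith [mul_nonneg hL0.le h]
  obtain ⟨hq1, hq2⟩ : -M ≤ q ∧ q ≤ M := by
    refine abs_le.1 (abs_le_of_sq_le_sq ?_ hM0.le)
    have := mul_le_mul uM' LM hL0.le hM0.le
    rw [sq M]; linarith [sq_nonneg K]
  obtain ⟨hq1', hq2'⟩ : -M ≤ L - q ∧ L - q ≤ M := by
    refine abs_le.1 (abs_le_of_sq_le_sq ?_ hM0.le)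
    have h1 : (L - q) ^ 2 + K ^ 2 = v' * L := by rw [hv']; linear_combination hu'
    have := mul_le_mul vM' LM hL0.le hM0.le
    rw [sq M]; linarith [sq_nonneg K]
  -- the angle at `c` is obtuse
  have hobt : L * (u - p) ≤ -1 / 8 := by
    have h1 : L * (u - p) = H ^ 2 - p * (L - p) := by linear_combination (-1) * hu
    linarith [quarter p hp hp']
  have hup := neg_of _ hobt
  have hobt' : M * (u - p) ≤ -1 / 8 := (mul_le_mul_of_nonpos_right LM hup.le).trans hobt
  have hK : K ≤ 8 * M ^ 2 * H := by
    rcases le_or_gt X 0 with hX0 | hX0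
    · have h1 : q * H + K * p ≤ 0 := hX ▸ mul_nonpos_of_nonpos_of_nonneg hX0 hL0.le
      have h2 : -M * H ≤ q * H := mul_le_mul_of_nonneg_right hq1 H0.le
      have h3 : K * (1 / 2) ≤ K * p := mul_le_mul_of_nonneg_left hp K0.le
      linarith
    rcases le_or_gt Y 0 with hY0 | hY0
    · have h1 : (L - q) * H + K * (L - p) ≤ 0 :=
        hY ▸ mul_nonpos_of_nonpos_of_nonneg hY0 hL0.le
      have h2 : -M * H ≤ (L - q) * H := mul_le_mul_of_nonneg_right hq1' H0.le
      have h3 : K * (1 / 2) ≤ K * (L - p) := mul_le_mul_of_nonneg_left hp' K0.le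
      linarith
    · have h1 := mul_nonneg hM0.le (hflip hX0 hY0)
      have h2 : H * (u' - q) ≤ H * M := mul_le_mul_of_nonneg_left (by linarith) H0.le
      have h3 := mul_le_mul_of_nonneg_left h2 hM0.le
      have h4 := mul_le_mul_of_nonneg_left hobt' K0.le
      linarith
  refine ⟨hK, ?_⟩
  -- otherwise the angle at `d` is obtuse as well, and `ab` could be flipped
  by_contra! hlong
  have hq3 : 1 / 2 ≤ q := by linarith
  have hq4 : 1 / 2 ≤ L - q := by linarith
  have hX0 : 0 < X := by
    have : 0 < X * L := by rw [hX]; positivity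
    exact pos_of_mul_pos_left this hL0.le
  have hY0 : 0 < Y := by
    have h1 : 0 < L - p := by linarith
    have h2 : 0 < L - q := by linarith
    have : 0 < Y * L := by rw [hY]; positivity
    exact pos_of_mul_pos_left this hL0.le
  have hK8 : K ^ 2 ≤ 1 / 8 := sq_le K K0 (by linarith)
  have hobt2 : L * (u' - q) ≤ -1 / 8 := by
    have h1 : L * (u' - q) = K ^ 2 - q * (L - q) := by linear_combination (-1) * hu'
    linarith [quarter q hq3 hq4]
  have h1 := hflip hX0 hY0
  have h2 := mul_neg_of_pos_of_neg K0 hup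
  have h3 := mul_neg_of_pos_of_neg H0 (neg_of _ hobt2)
  linarith

section minimal

variable {n : ℕ} {Q : Set Plane} {P : Polygon Plane n} {T : Finset (Finset Plane)} {M : ℝ}

/-- In a triangulation of least cost, a flat triangle has a neighbour across its longest side that
is almost as flat and has a longer longest side. -/
lemma IsTriangulation.exists_flatter (hP : IsPolygonWith Q P)
    (hT : IsTriangulation P.vertexFinset Q T)
    (hmin : ∀ T', IsTriangulation P.vertexFinset Q T' →
      ∑ t ∈ T, delaunayCost t ≤ ∑ t ∈ T', delaunayCost t)
    (hedge : ∀ x y, IsPolygonEdge P x y → dist x y = 1)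
    (hdist : ∀ x ∈ P.vertexFinset, ∀ y ∈ P.vertexFinset, x ≠ y → 1 ≤ dist x y)
    (hM : 1 ≤ M) (hdM : ∀ x ∈ P.vertexFinset, ∀ y ∈ P.vertexFinset, dist x y ^ 2 ≤ M)
    {a b c : Plane} (ht : ({a, b, c} : Finset Plane) ∈ T) (h : 0 < orient a b c)
    (hac : dist a c ≤ dist a b) (hbc : dist b c ≤ dist a b)
    (hflat : orient a b c * (24 * M ^ 2) ≤ 1) :
    ∃ d, ({a, b, d} : Finset Plane) ∈ T ∧ orient a b d < 0 ∧
      |orient a b d| ≤ 8 * M ^ 2 * orient a b c ∧ (dist a b < dist a d ∨ dist a b < dist b d) := by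
  have e := hT.isEmptyTriangle _ ht
  have haV : a ∈ P.vertexFinset := e.subset (by simp)
  have hbV : b ∈ P.vertexFinset := e.subset (by simp)
  have hcV : c ∈ P.vertexFinset := e.subset (by simp)
  obtain ⟨nab, nbc, nac⟩ := ne_of_orient h.ne'
  have hn : ∀ x y : Plane, dist x y ^ 2 = ‖y - x‖ ^ 2 := fun x y => by
    rw [dist_comm, dist_eq_norm]
  have hsq : ∀ x ∈ P.vertexFinset, ∀ y ∈ P.vertexFinset, x ≠ y → 1 ≤ dist x y ^ 2 :=
    fun x hx y hy hxy => one_le_pow₀ (hdist x hx y hy hxy)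
  have uL : dist a c ^ 2 ≤ dist a b ^ 2 := pow_le_pow_left₀ dist_nonneg hac 2
  have vL : dist b c ^ 2 ≤ dist a b ^ 2 := pow_le_pow_left₀ dist_nonneg hbc 2
  have hu : inner ℝ (c - a) (b - a) ^ 2 + orient a b c ^ 2 = dist a c ^ 2 * dist a b ^ 2 := by
    simp only [hn, norm_sq_plane, inner_plane, orient, PiLp.sub_apply]; ring
  have hv : dist b c ^ 2 = dist a c ^ 2 - 2 * inner ℝ (c - a) (b - a) + dist a b ^ 2 := by
    simp only [hn, norm_sq_plane, inner_plane, PiLp.sub_apply]; ring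
  have hne : ¬ IsPolygonEdge P a b := by
    intro hE
    have h1 := hedge a b hE
    have u1 := hsq a haV c hcV nac
    have v1 := hsq b hbV c hcV nbc
    rw [h1] at uL vL hu hv
    have hH : orient a b c * 24 ≤ orient a b c * (24 * M ^ 2) :=
      mul_le_mul_of_nonneg_left (by linarith [one_le_pow₀ (n := 2) hM]) h.le
    have hH2 : orient a b c ^ 2 ≤ (1 / 24) ^ 2 := pow_le_pow_left₀ h.le (by linarith) 2
    have hp : inner ℝ (c - a) (b - a) = (1 / 2 : ℝ) := by linarith
    rw [hp] at hu
    linarith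
  obtain ⟨d, htd, hd⟩ := hT.exists_adjacent hP ht h hne
  refine ⟨d, htd, hd, ?_⟩
  have hdV : d ∈ P.vertexFinset := (hT.isEmptyTriangle _ htd).subset (by simp)
  obtain ⟨-, nbd, nad⟩ := ne_of_orient hd.ne
  have hK : orient a d b = -orient a b d := orient_swap_right _ _ _
  have key := flat_of_flat (L := dist a b ^ 2) (u := dist a c ^ 2) (v := dist b c ^ 2)
    (p := inner ℝ (c - a) (b - a)) (H := orient a b c) (u' := dist a d ^ 2) (v' := dist b d ^ 2)
    (q := inner ℝ (d - a) (b - a)) (K := orient a d b) (X := orient a d c) (Y := orient d b c)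
    hM hu hv
    (by simp only [hn, norm_sq_plane, inner_plane, orient, PiLp.sub_apply]; ring)
    (by simp only [hn, norm_sq_plane, inner_plane, PiLp.sub_apply]; ring)
    (by simp only [hn, norm_sq_plane, inner_plane, orient, PiLp.sub_apply]; ring)
    (by simp only [hn, norm_sq_plane, inner_plane, orient, PiLp.sub_apply]; ring)
    (hsq a haV c hcV nac) (hsq b hbV c hcV nbc) (hsq a haV b hbV nab) (hsq a haV d hdV nad)
    (hsq b hbV d hdV nbd) (hdM a haV b hbV) (hdM a haV d hdV) (hdM b hbV d hdV) uL vL h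
    (by rw [hK]; linarith) hflat (by
      intro hX hY
      have e1 : ({a, b, c} : Finset Plane) = {b, c, a} := by ext; simp; tauto
      have e2 : ({a, b, d} : Finset Plane) = {a, d, b} := by ext; simp; tauto
      rw [e1] at ht
      rw [e2] at htd
      have := hT.flip_inequality hmin ht htd (by rw [hK]; linarith)
        (by rw [orient_rotate]; exact h) hY (by rw [← orient_rotate]; exact hX)
      refine this.trans_eq ?_
      simp only [hn, norm_sq_plane, inner_plane, orient, PiLp.sub_apply]; ring)
  rw [hK] at key
  refine ⟨by rw [abs_of_neg hd]; exact key.1, ?_⟩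
  rcases key.2 with h' | h'
  · exact Or.inl (lt_of_pow_lt_pow_left₀ 2 dist_nonneg h')
  · exact Or.inr (lt_of_pow_lt_pow_left₀ 2 dist_nonneg h')

lemma IsEmptyTriangle.exists_longest {V t : Finset Plane} (ht : IsEmptyTriangle V t) :
    ∃ a b c, t = {a, b, c} ∧ 0 < orient a b c ∧ dist a c ≤ dist a b ∧ dist b c ≤ dist a b := by
  obtain ⟨a, b, c, rfl, h⟩ := ht.exists_orient
  have h1 : orient b c a = orient a b c := orient_rotate a b c
  have h2 : orient c a b = orient a b c := by rw [orient_rotate b c a, h1]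
  have e1 : ({a, b, c} : Finset Plane) = {b, c, a} := by ext; simp; tauto
  have e2 : ({a, b, c} : Finset Plane) = {c, a, b} := by ext; simp; tauto
  rcases le_total (dist a b) (dist b c) with k1 | k1
  · rcases le_total (dist b c) (dist c a) with k2 | k2
    · exact ⟨c, a, b, e2, by rwa [h2], by rwa [dist_comm c b], k1.trans k2⟩
    · exact ⟨b, c, a, e1, by rwa [h1], by rwa [dist_comm b a], k2⟩
  · rcases le_total (dist a b) (dist c a) with k2 | k2
    · exact ⟨c, a, b, e2, by rwa [h2], by rw [dist_comm c b]; exact k1.trans k2, k2⟩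
    · exact ⟨a, b, c, rfl, h, by rwa [dist_comm a c], k1⟩

/-- In a triangulation of least cost no triangle is very flat: moving across longest sides from
flat triangles to flat triangles with longer and longer longest sides must come to an end. The
induction is on the number `k` of pairs of vertices farther apart than the longest side. -/
lemma IsTriangulation.le_doubleArea (hP : IsPolygonWith Q P)
    (hT : IsTriangulation P.vertexFinset Q T)
    (hmin : ∀ T', IsTriangulation P.vertexFinset Q T' →
      ∑ t ∈ T, delaunayCost t ≤ ∑ t ∈ T', delaunayCost t)
    (hedge : ∀ x y, IsPolygonEdge P x y → dist x y = 1)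
    (hdist : ∀ x ∈ P.vertexFinset, ∀ y ∈ P.vertexFinset, x ≠ y → 1 ≤ dist x y)
    (hM : 1 ≤ M) (hdM : ∀ x ∈ P.vertexFinset, ∀ y ∈ P.vertexFinset, dist x y ^ 2 ≤ M)
    (k : ℕ) {a b c : Plane} (ht : ({a, b, c} : Finset Plane) ∈ T) (h : 0 < orient a b c)
    (hac : dist a c ≤ dist a b) (hbc : dist b c ≤ dist a b)
    (hk : ((P.vertexFinset ×ˢ P.vertexFinset).filter
      fun xy => dist a b < dist xy.1 xy.2).card ≤ k) :
    1 / (24 * M ^ 2) / (8 * M ^ 2) ^ k ≤ orient a b c := by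
  induction k generalizing a b c with
  | zero =>
    by_contra! hlt
    rw [pow_zero, div_one, lt_div_iff₀ (by positivity)] at hlt
    obtain ⟨d, htd, -, -, hlong⟩ :=
      hT.exists_flatter hP hmin hedge hdist hM hdM ht h hac hbc hlt.le
    have e := hT.isEmptyTriangle _ htd
    have hempty := Finset.card_eq_zero.1 (Nat.le_zero.1 hk)
    rcases hlong with hl | hl
    · refine Finset.eq_empty_iff_forall_notMem.1 hempty (a, d) (Finset.mem_filter.2 ⟨?_, hl⟩)
      exact Finset.mk_mem_product (e.subset (by simp)) (e.subset (by simp))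
    · refine Finset.eq_empty_iff_forall_notMem.1 hempty (b, d) (Finset.mem_filter.2 ⟨?_, hl⟩)
      exact Finset.mk_mem_product (e.subset (by simp)) (e.subset (by simp))
  | succ k ih =>
    have hC : 1 ≤ 8 * M ^ 2 := by nlinarith
    rcases le_or_gt (1 / (24 * M ^ 2)) (orient a b c) with hbig | hlt
    · exact (div_le_self (by positivity) (one_le_pow₀ hC)).trans hbig
    rw [lt_div_iff₀ (by positivity)] at hlt
    obtain ⟨d, htd, hd, hK, hlong⟩ :=
      hT.exists_flatter hP hmin hedge hdist hM hdM ht h hac hbc hlt.le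
    obtain ⟨a', b', c', heq, h', hac', hbc'⟩ := (hT.isEmptyTriangle _ htd).exists_longest
    have harea : orient a' b' c' = |orient a b d| := by
      rw [← doubleArea_triple hd.ne, heq, doubleArea_triple h'.ne', abs_of_pos h']
    have hmax : ∀ x ∈ ({a', b', c'} : Finset Plane), ∀ y ∈ ({a', b', c'} : Finset Plane),
        dist x y ≤ dist a' b' := by
      intro x hx y hy
      simp only [Finset.mem_insert, Finset.mem_singleton] at hx hy
      rcases hx with rfl | rfl | rfl <;> rcases hy with rfl | rfl | rfl <;>
        first | exact le_rfl | (rw [dist_self]; exact dist_nonneg) | assumption |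
          (rw [dist_comm]; assumption) | exact (dist_comm _ _).le
    have hlonger : dist a b < dist a' b' := by
      rw [← heq] at hmax
      rcases hlong with hl | hl
      · exact hl.trans_le (hmax a (by simp) d (by simp))
      · exact hl.trans_le (hmax b (by simp) d (by simp))
    rw [heq] at htd
    have e := hT.isEmptyTriangle _ htd
    have := ih htd h' hac' hbc' (by
      refine Nat.le_of_lt_succ (lt_of_lt_of_le (Finset.card_lt_card ?_) hk)
      refine (Finset.ssubset_iff_of_subset ?_).2 ⟨(a', b'), ?_, ?_⟩
      · intro xy hxy
        rw [Finset.mem_filter] at hxy ⊢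
        exact ⟨hxy.1, hlonger.trans hxy.2⟩
      · exact Finset.mem_filter.2
          ⟨Finset.mk_mem_product (e.subset (by simp)) (e.subset (by simp)), hlonger⟩
      · intro hmem
        exact lt_irrefl _ (Finset.mem_filter.1 hmem).2)
    rw [harea] at this
    rw [pow_succ (8 * M ^ 2) k, ← div_div, div_le_iff₀ (by positivity)]
    linarith [this.trans hK]

end minimal

/-! ### Metric facts -/

lemma abs_orient_eq (a b c : Plane) :
    |orient a b c| = Real.sin (EuclideanGeometry.angle a b c) * (dist a b * dist c b) := by
  rw [EuclideanGeometry.angle, dist_eq_norm, dist_eq_norm, vsub_eq_sub, vsub_eq_sub,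
    InnerProductGeometry.sin_angle_mul_norm_mul_norm, ← Real.sqrt_sq_eq_abs]
  congr 1
  simp only [inner_plane, orient, PiLp.sub_apply]
  ring

/-- The boundary curve of length `n` bounds the distances between vertices. -/
lemma dist_vertices_le {n : ℕ} {P : Polygon Plane n}
    (h : ∀ i : Fin n, dist (P i) (P (finRotate n i)) = 1) (i j : Fin n) :
    dist (P i) (P j) ≤ 2 * n := by
  obtain _ | m := n
  · exact i.elim0
  have key : ∀ k : ℕ, ∀ hk : k < m + 1, dist (P 0) (P ⟨k, hk⟩) ≤ k := by
    intro k
    induction k with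
    | zero => intro hk; simp
    | succ k ih =>
      intro hk
      have h1 := h ⟨k, by omega⟩
      rw [finRotate_of_lt (by omega)] at h1
      have h2 := dist_triangle (P 0) (P ⟨k, by omega⟩) (P ⟨k + 1, hk⟩)
      have h3 := ih (by omega)
      push_cast
      linarith
  have hi := key i i.2
  have hj := key j j.2
  have h1 := dist_triangle_left (P i) (P j) (P 0)
  have hi' : ((i : ℕ) : ℝ) ≤ (m + 1 : ℕ) := by exact_mod_cast i.2.le
  have hj' : ((j : ℕ) : ℝ) ≤ (m + 1 : ℕ) := by exact_mod_cast j.2.le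
  simp only [Fin.eta] at hi hj
  linarith

/-! ### The simplicial complex of a triangulation -/

section complex

variable {n : ℕ} {Q : Set Plane} {P : Polygon Plane n} {T : Finset (Finset Plane)}
  {V : Finset Plane}

/-- The simplicial complex of all faces of the triangles of a packing. -/
def IsPacking.complex (hT : IsPacking V Q T) : Geometry.SimplicialComplex ℝ Plane where
  faces := {s | s.Nonempty ∧ ∃ t ∈ T, s ⊆ t}
  isRelLowerSet_faces := by
    rintro s ⟨hs, t, ht, hst⟩
    exact ⟨hs, fun u hu hne => ⟨hne, t, ht, hu.trans hst⟩⟩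
  indep := by
    rintro s ⟨-, t, ht, hst⟩
    exact (hT.isEmptyTriangle t ht).affineIndependent.mono hst
  inter_subset_convexHull := by
    rintro s s' ⟨-, t, ht, hst⟩ ⟨-, t', ht', hst'⟩ x ⟨hx, hx'⟩
    have h1 := hT.inter_subset ht ht' ⟨convexHull_mono hst hx, convexHull_mono hst' hx'⟩
    have i := (hT.isEmptyTriangle t ht).affineIndependent
    have i' := (hT.isEmptyTriangle t' ht').affineIndependent
    have h2 : x ∈ convexHull ℝ ((s ∩ t' : Finset Plane) : Set Plane) := by
      have := i.convexHull_inter hst (t₂ := t ∩ t') Finset.inter_subset_left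
      have hx2 : x ∈ convexHull ℝ (s : Set Plane) ∩ convexHull ℝ ((t ∩ t' : Finset Plane)) :=
        ⟨hx, by rwa [Finset.coe_inter]⟩
      rw [← this] at hx2
      refine convexHull_mono ?_ hx2
      rintro y ⟨hy, hy'⟩
      simp only [Finset.coe_inter, mem_inter_iff, Finset.mem_coe] at hy hy' ⊢
      exact ⟨hy, hy'.2⟩
    have hx3 : x ∈ convexHull ℝ ((s ∩ t' : Finset Plane) : Set Plane) ∩
        convexHull ℝ (s' : Set Plane) := ⟨h2, hx'⟩
    rw [← i'.convexHull_inter Finset.inter_subset_right hst'] at hx3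
    refine convexHull_mono ?_ hx3
    rintro y ⟨hy, hy'⟩
    simp only [Finset.coe_inter, mem_inter_iff, Finset.mem_coe] at hy hy' ⊢
    exact ⟨hy.1, hy'⟩

lemma IsTriangulation.isDiagonalTriangulation (hT : IsTriangulation P.vertexFinset Q T) :
    IsDiagonalTriangulation Q P hT.complex := by
  refine ⟨?_, ?_, ?_, ?_⟩
  · refine (T.biUnion Finset.powerset).finite_toSet.subset ?_
    rintro s ⟨-, t, ht, hst⟩
    exact Finset.mem_coe.2 (Finset.mem_biUnion.2 ⟨t, ht, Finset.mem_powerset.2 hst⟩)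
  · ext x
    rw [Geometry.SimplicialComplex.mem_space_iff]
    constructor
    · rintro ⟨s, ⟨-, t, ht, hst⟩, hx⟩
      exact hT.subset t ht (convexHull_mono hst hx)
    · intro hx
      have := hT.cover hx
      simp only [mem_iUnion] at this
      obtain ⟨t, ht, hxt⟩ := this
      refine ⟨t, ⟨?_, t, ht, subset_rfl⟩, hxt⟩
      rw [← Finset.coe_nonempty, ← convexHull_nonempty_iff (𝕜 := ℝ)]
      exact ⟨x, hxt⟩
  · rintro s ⟨-, t, ht, hst⟩
    obtain ⟨a, b, c, heq, h⟩ := (hT.isEmptyTriangle t ht).exists_orient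
    obtain ⟨hab, hbc, hac⟩ := ne_of_orient h.ne'
    refine ⟨t, ⟨?_, t, ht, subset_rfl⟩, hst, ?_⟩
    · rw [heq]; simp
    · rw [heq]; exact Finset.card_eq_three.2 ⟨a, b, c, hab, hac, hbc, rfl⟩
  · rintro s ⟨-, t, ht, hst⟩ v hv w hw hvw
    have e := hT.isEmptyTriangle t ht
    by_cases hE : IsPolygonEdge P v w
    · exact Or.inl hE
    right
    refine ⟨hvw, (segment_subset_convexHull (hst hv) (hst hw)).trans (hT.subset t ht), hE, ?_⟩
    ext x
    constructor
    · rintro ⟨hx, hxV⟩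
      exact e.side_empty (hst hv) (hst hw) hvw x (Polygon.mem_vertexFinset.2 hxV) hx
    · rintro (rfl | rfl)
      · exact ⟨left_mem_segment _ _ _, Polygon.mem_vertexFinset.1 (e.subset (hst hv))⟩
      · exact ⟨right_mem_segment _ _ _, Polygon.mem_vertexFinset.1 (e.subset (hst hw))⟩

end complex

/-! ### The bound on the angles -/

lemma IsPolygonWith.exists_min_triangulation {n : ℕ} {Q : Set Plane} {P : Polygon Plane n}
    (hP : IsPolygonWith Q P) :
    ∃ T, IsTriangulation P.vertexFinset Q T ∧ ∀ T', IsTriangulation P.vertexFinset Q T' →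
      ∑ t ∈ T, delaunayCost t ≤ ∑ t ∈ T', delaunayCost t := by
  obtain ⟨T₀, hT₀, hcov⟩ := hP.exists_triangulation
  have hT₀' : IsTriangulation P.vertexFinset Q T₀ := ⟨hT₀, hcov⟩
  obtain ⟨T, hT, hmin⟩ := (P.vertexFinset.powerset.powerset.filter
    (fun T => IsTriangulation P.vertexFinset Q T)).exists_min_image
    (fun T => ∑ t ∈ T, delaunayCost t) ⟨T₀, Finset.mem_filter.2 ⟨hT₀.mem_powerset, hT₀'⟩⟩
  exact ⟨T, (Finset.mem_filter.1 hT).2, fun T' hT' =>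
    hmin T' (Finset.mem_filter.2 ⟨hT'.mem_powerset, hT'⟩)⟩

theorem theorem3p2 (n : ℕ) :
    ∃ θ : ℝ, 0 < θ ∧
      ∀ (Q : Set Plane) (P : Polygon Plane n),
        IsPolygonWith Q P →
        (∀ i : Fin n, dist (P i) (P (finRotate n i)) = 1) →
        (∀ i j : Fin n, P i ≠ P j → 1 ≤ dist (P i) (P j)) →
        ∃ K : Geometry.SimplicialComplex ℝ Plane,
          IsDiagonalTriangulation Q P K ∧
          ∀ t ∈ K.faces, ∀ a ∈ t, ∀ b ∈ t, ∀ c ∈ t, a ≠ b → b ≠ c → a ≠ c →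
            θ ≤ EuclideanGeometry.angle a b c := by
  -- `M` bounds the squared distances between vertices; the `1` keeps it positive for `n = 0`
  set M : ℝ := (2 * n + 1) ^ 2 with hMdef
  have hn0 : (0 : ℝ) ≤ n := n.cast_nonneg
  have hM : 1 ≤ M := one_le_pow₀ (by linarith)
  have hM0 : 0 < M := by linarith
  refine ⟨1 / (24 * M ^ 2) / (8 * M ^ 2) ^ (n * n) / M, by positivity, ?_⟩
  intro Q P hP hedge hdist
  obtain ⟨T, hT, hmin⟩ := hP.exists_min_triangulation
  refine ⟨hT.complex, hT.isDiagonalTriangulation, ?_⟩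
  have hedge' : ∀ x y, IsPolygonEdge P x y → dist x y = 1 := by
    rintro x y ⟨i, hi⟩
    rcases Sym2.eq_iff.1 hi with ⟨rfl, rfl⟩ | ⟨rfl, rfl⟩
    · exact hedge i
    · rw [dist_comm]; exact hedge i
  have hdist' : ∀ x ∈ P.vertexFinset, ∀ y ∈ P.vertexFinset, x ≠ y → 1 ≤ dist x y := by
    intro x hx y hy hxy
    obtain ⟨i, rfl⟩ := Polygon.mem_vertexFinset.1 hx
    obtain ⟨j, rfl⟩ := Polygon.mem_vertexFinset.1 hy
    exact hdist i j hxy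
  have hle : ∀ x ∈ P.vertexFinset, ∀ y ∈ P.vertexFinset, dist x y ≤ 2 * n + 1 := by
    intro x hx y hy
    obtain ⟨i, rfl⟩ := Polygon.mem_vertexFinset.1 hx
    obtain ⟨j, rfl⟩ := Polygon.mem_vertexFinset.1 hy
    linarith [dist_vertices_le hedge i j]
  have hdM : ∀ x ∈ P.vertexFinset, ∀ y ∈ P.vertexFinset, dist x y ^ 2 ≤ M :=
    fun x hx y hy => pow_le_pow_left₀ dist_nonneg (hle x hx y hy) 2
  rintro s ⟨-, t, ht, hst⟩ a ha b hb c hc hab hbc hac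
  have e := hT.isEmptyTriangle t ht
  have harea : 1 / (24 * M ^ 2) / (8 * M ^ 2) ^ (n * n) ≤ doubleArea t := by
    obtain ⟨a', b', c', rfl, h', hac', hbc'⟩ := e.exists_longest
    rw [doubleArea_triple h'.ne', abs_of_pos h']
    refine hT.le_doubleArea hP hmin hedge' hdist' hM hdM (n * n) ht h' hac' hbc' ?_
    refine (Finset.card_filter_le _ _).trans ?_
    rw [Finset.card_product]
    have : P.vertexFinset.card ≤ n := by
      refine Finset.card_image_le.trans ?_
      simp
    exact Nat.mul_le_mul this this
  obtain ⟨c', heq, hor⟩ := e.exists_third (hst ha) (hst hb) hab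
  have hcc' : c = c' := by
    have := hst hc
    rw [heq] at this
    simp only [Finset.mem_insert, Finset.mem_singleton] at this
    tauto
  subst hcc'
  rw [heq, doubleArea_triple hor, abs_orient_eq] at harea
  have hang : 0 ≤ EuclideanGeometry.angle a b c := EuclideanGeometry.angle_nonneg _ _ _
  rw [div_le_iff₀ hM0]
  refine harea.trans ?_
  have h1 : dist a b * dist c b ≤ M := by
    rw [hMdef, sq]
    exact mul_le_mul (hle a (e.subset (hst ha)) b (e.subset (hst hb)))
      (hle c (e.subset (hst hc)) b (e.subset (hst hb))) dist_nonneg (by linarith)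
  exact mul_le_mul (Real.sin_le hang) h1 (by positivity) hang
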